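/- Let $\tilde{\mathcal M}$ be a rigid special pseudo-Kähler manifold: a complex manifold with complex structure $J$, a pseudo-Kähler metric $\tilde g$ (a smooth, $J$-invariant, nondegenerate symmetric bilinear form of any signature whose fundamental form $\Phi(X,Y)=\tilde g(X,JY)$ is closed), and a real, flat, torsionfree connection $\tilde\nabla$ with $\tilde\nabla\Phi=0$ and $d_{\tilde\nabla}J=0$. Metric, connections and Lie brackets are extended complex (bi)linearly to the complexified tangent bundle. Assume that $\mathbb C^\times$ acts freely and holomorphically on $\tilde{\mathcal M}$, let $H$ be the fundamental vector field (the vector field of type $(1,0)$ with $Hf(x)=\frac{d}{d\lambda}\big|_{\lambda=0}f(e^{\lambda}\cdot x)$ for holomorphic $f$), assume $\tilde g(H,\bar H)\neq 0$ everywhere, and assume that for a constant $c\in\mathbb C$ $$\tilde\nabla_YH=cY\qquad\text{for all } Y\in T^{1,0}\tilde{\mathcal M}.$$ Then $H$ is also a holomorphic homothetic Killing vector for the Levi-Civita connection $\tilde D$ of $\tilde g$: $H$ is a holomorphic vector field of type $(1,0)$, and $$\tilde D_YH=cY\quad\text{for all } Y\in T^{1,0}\tilde{\mathcal M},\qquad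 \mathcal L_H\tilde g=c\,\tilde g .$$ Assume moreover $c\neq0$. Let $\eta^1,\dots,\eta^n$ be special coordinates on a connected open set $U\subset\tilde{\mathcal M}$, with conjugate functions $\lambda_1,\dots,\lambda_n$. That is, $\eta=(\eta^1,\dots,\eta^n)$ is a holomorphic coordinate system on $U$, the $\lambda_j$ are holomorphic on $U$, and $x^j=\operatorname{Re}\eta^j$, $y_j=-\operatorname{Re}\lambda_j$ are flat Darboux coordinates: $\tilde\nabla dx^j=\tilde\nabla dy_j=0$ and $\Phi=\sum_j dx^j\wedge dy_j$. Then one can add constants to the $\eta^\alpha$ and to the $\lambda_j$ such that the new functions, denoted in the same way, are again special coordinates and conjugate functions on $U$, and such that the following hold, where $\Omega=\eta(U)\subset\mathbb C^n$. 1. $H=c\sum_\alpha\eta^\alpha\frac{\partial}{\partial\eta^\alpha}$ on $U$, and the special coordinates are homogeneous: $\eta(e^{\lambda}\cdot p)=e^{c\lambda}\eta(p)$ whenever $p\in U$ and $\lambda$ lies in the path component of $0$ in $\{\mu\in\mathbb C: e^{\mu}\cdot p\in U\}$. 2. The functions $\tau_{\alpha\beta}=\partial\lambda_\beta/\partial\eta^\alpha$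 are homogeneous of degree $0$ in $\eta$. 3. There is a prepotential, i.e. a holomorphic function $\mathcal F$ on $\Omega$ with $\lambda_j=-8\,\partial\mathcal F/\partial\eta^j$ for all $j$, that is homogeneous of degree $2$ in $\eta$; and every prepotential becomes homogeneous of degree $2$ after adding a constant. Here a function $f$ on $\Omega$ is called homogeneous of degree $k$ if $f(\lambda\eta)=\lambda^kf(\eta)$ for all $\eta\in\Omega$ and all $\lambda$ in the path component of $1$ in $\{\mu\in\mathbb C^\times:\mu\eta\in\Omega\}$ (hence for all $\lambda\in\mathbb C^\times$ if $\Omega$ is invariant under multiplication by $\mathbb C^\times$). -/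

import Mathlib

open scoped Manifold ContDiff
open Bundle

namespace SpecialKahler

noncomputable section

/-! ### Complexification of a real vector space -/

/-- The complexification `V ⊕ iV` of a real vector space `V`; the pair `(a, b)` stands for
`a + i b`. -/
def Cx (V : Type*) : Type _ := V × V

namespace Cx

variable {V : Type*}

/-- The vector `a + i b`. -/
def mk (a b : V) : Cx V := (a, b)

/-- The real part of `a + i b`. -/
def re (Z : Cx V) : V := Prod.fst Z

/-- The imaginary part of `a + i b`. -/
def im (Z : Cx V) : V := Prod.snd Z

@[simp] theorem re_mk (a b : V) : (mk a b).re = a := rfl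

@[simp] theorem im_mk (a b : V) : (mk a b).im = b := rfl

@[ext] theorem ext {Z W : Cx V} (h₁ : Z.re = W.re) (h₂ : Z.im = W.im) : Z = W :=
  Prod.ext h₁ h₂

variable [AddCommGroup V]

instance : AddCommGroup (Cx V) := inferInstanceAs (AddCommGroup (V × V))

@[simp] theorem re_add (Z W : Cx V) : (Z + W).re = Z.re + W.re := rfl

@[simp] theorem im_add (Z W : Cx V) : (Z + W).im = Z.im + W.im := rfl

@[simp] theorem re_zero : (0 : Cx V).re = 0 := rfl

@[simp] theorem im_zero : (0 : Cx V).im = 0 := rfl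

variable [Module ℝ V]

instance : SMul ℂ (Cx V) :=
  ⟨fun c Z ↦ mk (c.re • Z.re - c.im • Z.im) (c.re • Z.im + c.im • Z.re)⟩

@[simp] theorem re_smul (c : ℂ) (Z : Cx V) : (c • Z).re = c.re • Z.re - c.im • Z.im := rfl

@[simp] theorem im_smul (c : ℂ) (Z : Cx V) : (c • Z).im = c.re • Z.im + c.im • Z.re := rfl

instance : Module ℂ (Cx V) where
  one_smul Z := by ext <;> simp
  mul_smul c d Z := by
    ext <;> simp only [re_smul, im_smul, Complex.mul_re, Complex.mul_im] <;> module
  smul_zero c := by ext <;> simp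
  smul_add c Z W := by ext <;> simp <;> module
  add_smul c d Z := by ext <;> simp <;> module
  zero_smul Z := by ext <;> simp

/-- Complex conjugation `a + i b ↦ a - i b`. -/
def conj (Z : Cx V) : Cx V := mk Z.re (-Z.im)

end Cx

/-! ### Complex manifolds

`M` is a complex manifold, given by holomorphic charts with values in a finite dimensional complex
vector space `E`. It is also a real manifold, with the same charts. -/

section Manifold

variable {E : Type*} [NormedAddCommGroup E] [NormedSpace ℂ E]
variable {M : Type*} [TopologicalSpace M] [ChartedSpace E M]

/-- A complex manifold is a real analytic manifold. -/
instance instIsManifoldReal [hM : IsManifold 𝓘(ℂ, E) ω M] : IsManifold 𝓘(ℝ, E) ω M := by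
  refine isManifold_of_contDiffOn _ _ _ fun e e' he he' ↦ ?_
  have h := (contDiffGroupoid ω 𝓘(ℂ, E)).compatible he he'
  rw [contDiffGroupoid, mem_groupoid_of_pregroupoid] at h
  exact ContDiffOn.restrict_scalars ℝ h.1

/-- The complex structure on a (real) tangent space of a complex manifold: multiplication by `i` in
any holomorphic chart. -/
def J (x : M) : TangentSpace 𝓘(ℝ, E) x →L[ℝ] TangentSpace 𝓘(ℝ, E) x :=
  (Complex.I • ContinuousLinearMap.id ℝ E : E →L[ℝ] E)

/-- The complexified tangent space `T_x M ⊗ ℂ`. -/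
abbrev TangentCx (x : M) : Type _ := Cx (TangentSpace 𝓘(ℝ, E) x)

/-- The complex structure, extended complex linearly. -/
def JCx (x : M) (Z : TangentCx (E := E) x) : TangentCx (E := E) x :=
  Cx.mk (J x Z.re) (J x Z.im)

/-- `Z` is of type `(1, 0)`: an eigenvector of the complex structure for the eigenvalue `i`. -/
def IsType10 (x : M) (Z : TangentCx (E := E) x) : Prop := JCx x Z = Complex.I • Z

/-- A tangent vector of the complex manifold `M`, as a tangent vector of the underlying real
manifold (both tangent spaces are `E`). -/
def toReal (x : M) (v : TangentSpace 𝓘(ℂ, E) x) : TangentSpace 𝓘(ℝ, E) x := v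

/-- The isomorphism `v ↦ (v - i J v) / 2` from the holomorphic tangent space `T_x M` onto
`T_x^{1,0} M`. It maps the vector with components `v ^ α` in a holomorphic coordinate system `z ^ α`
to `∑ v ^ α ∂/∂z ^ α`. -/
def toType10 (x : M) (v : TangentSpace 𝓘(ℂ, E) x) : TangentCx (E := E) x :=
  (1 / 2 : ℂ) • Cx.mk (toReal x v) (-(J x (toReal x v)))

/-- The derivative of a complex function along a complex tangent vector. -/
def derivCx (f : M → ℂ) (x : M) (Z : TangentCx (E := E) x) : ℂ :=
  mvfderiv 𝓘(ℝ, E) f x Z.re + Complex.I * mvfderiv 𝓘(ℝ, E) f x Z.im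

variable [IsManifold 𝓘(ℂ, E) ω M]

/-- The real vector field `X` is differentiable at `x`. -/
def VDiffAt (X : Π x : M, TangentSpace 𝓘(ℝ, E) x) (x : M) : Prop :=
  MDifferentiableAt 𝓘(ℝ, E) (𝓘(ℝ, E).prod 𝓘(ℝ, E))
    (fun y ↦ (TotalSpace.mk' E y (X y) : TangentBundle 𝓘(ℝ, E) M)) x

/-- The real vector field `X` is smooth on `U`. -/
def VSmoothOn (X : Π x : M, TangentSpace 𝓘(ℝ, E) x) (U : Set M) : Prop :=
  ContMDiffOn 𝓘(ℝ, E) (𝓘(ℝ, E).prod 𝓘(ℝ, E)) ∞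
    (fun y ↦ (TotalSpace.mk' E y (X y) : TangentBundle 𝓘(ℝ, E) M)) U

/-- The Lie bracket of real vector fields, extended complex bilinearly. -/
def bracketCx (X Y : Π x : M, TangentCx (E := E) x) (x : M) : TangentCx (E := E) x :=
  Cx.mk
    (VectorField.mlieBracket 𝓘(ℝ, E) (fun y ↦ (X y).re) (fun y ↦ (Y y).re) x
      - VectorField.mlieBracket 𝓘(ℝ, E) (fun y ↦ (X y).im) (fun y ↦ (Y y).im) x)
    (VectorField.mlieBracket 𝓘(ℝ, E) (fun y ↦ (X y).re) (fun y ↦ (Y y).im) x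
      + VectorField.mlieBracket 𝓘(ℝ, E) (fun y ↦ (X y).im) (fun y ↦ (Y y).re) x)

variable (E M) in
/-- Linear connections on `M` (covariant derivatives of real vector fields). In the notation of
Mathlib `∇ Y x v` is the covariant derivative `∇_v Y` at `x`. -/
abbrev Connection : Type _ :=
  CovariantDerivative 𝓘(ℝ, E) E (fun x : M ↦ TangentSpace 𝓘(ℝ, E) x)

namespace Connection

variable (D : Connection E M)

/-- The connection has no torsion: `D_X Y - D_Y X = [X, Y]`. -/
def IsTorsionFree : Prop :=
  ∀ (X Y : Π x : M, TangentSpace 𝓘(ℝ, E) x) (x : M), VDiffAt X x → VDiffAt Y x →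
    D Y x (X x) - D X x (Y x) = VectorField.mlieBracket 𝓘(ℝ, E) X Y x

/-- The connection is flat: the curvature `[D_X, D_Y] Z - D_[X, Y] Z` vanishes for all local smooth
vector fields. -/
def IsFlat : Prop :=
  ∀ (X Y Z : Π x : M, TangentSpace 𝓘(ℝ, E) x) (U : Set M), IsOpen U →
    VSmoothOn X U → VSmoothOn Y U → VSmoothOn Z U → ∀ x ∈ U,
      D (fun y ↦ D Z y (Y y)) x (X x) - D (fun y ↦ D Z y (X y)) x (Y x)
        - D Z x (VectorField.mlieBracket 𝓘(ℝ, E) X Y x) = 0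

/-- The connection preserves the bilinear form `b`:
`X (b (Y, Z)) = b (D_X Y, Z) + b (Y, D_X Z)`. -/
def Preserves
    (b : Π x : M, TangentSpace 𝓘(ℝ, E) x → TangentSpace 𝓘(ℝ, E) x → ℝ) : Prop :=
  ∀ (Y Z : Π x : M, TangentSpace 𝓘(ℝ, E) x) (x : M), VDiffAt Y x → VDiffAt Z x →
    ∀ v : TangentSpace 𝓘(ℝ, E) x,
      mvfderiv 𝓘(ℝ, E) (fun y ↦ b y (Y y) (Z y)) x v = b x (D Y x v) (Z x) + b x (Y x) (D Z x v)

/-- The differential of the function `f` is parallel on `U`: `X (Y f) = (D_X Y) f`. -/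
def IsAffineOn (f : M → ℝ) (U : Set M) : Prop :=
  ∀ (Y : Π x : M, TangentSpace 𝓘(ℝ, E) x), ∀ x ∈ U, VDiffAt Y x →
    ∀ v : TangentSpace 𝓘(ℝ, E) x,
      mvfderiv 𝓘(ℝ, E) (fun y ↦ mvfderiv 𝓘(ℝ, E) f y (Y y)) x v = mvfderiv 𝓘(ℝ, E) f x (D Y x v)

/-- The covariant derivative `D_Z H` of a complex vector field along a complex tangent vector,
extended complex bilinearly. -/
def cx (H : Π x : M, TangentCx (E := E) x) (x : M) (Z : TangentCx (E := E) x) :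
    TangentCx (E := E) x :=
  Cx.mk
    (D (fun y ↦ (H y).re) x Z.re - D (fun y ↦ (H y).im) x Z.im)
    (D (fun y ↦ (H y).im) x Z.re + D (fun y ↦ (H y).re) x Z.im)

end Connection

/-! ### Special pseudo-Kähler manifolds -/

variable (E M) in
/-- A pseudo-Kähler metric on a complex manifold: a smooth nondegenerate symmetric bilinear form `g`
of any signature, invariant under the complex structure, whose fundamental form
`Φ (X, Y) = g (X, J Y)` is closed. -/
structure PseudoKahler where
  /-- the metric -/
  g : Π x : M, TangentSpace 𝓘(ℝ, E) x →L[ℝ] TangentSpace 𝓘(ℝ, E) x →L[ℝ] ℝ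
  smooth : ContMDiff 𝓘(ℝ, E) (𝓘(ℝ, E).prod 𝓘(ℝ, E →L[ℝ] E →L[ℝ] ℝ)) ∞
    (fun x ↦ TotalSpace.mk' (E →L[ℝ] E →L[ℝ] ℝ)
      (E := fun x : M ↦ TangentSpace 𝓘(ℝ, E) x →L[ℝ] TangentSpace 𝓘(ℝ, E) x →L[ℝ] ℝ) x (g x))
  symm : ∀ x v w, g x v w = g x w v
  nondegenerate : ∀ x v, (∀ w, g x v w = 0) → v = 0
  hermitian : ∀ x v w, g x (J x v) (J x w) = g x v w
  closed : ∀ (X Y Z : Π x : M, TangentSpace 𝓘(ℝ, E) x) (x : M),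
    VDiffAt X x → VDiffAt Y x → VDiffAt Z x →
      mvfderiv 𝓘(ℝ, E) (fun y ↦ g y (Y y) (J y (Z y))) x (X x)
        + mvfderiv 𝓘(ℝ, E) (fun y ↦ g y (Z y) (J y (X y))) x (Y x)
        + mvfderiv 𝓘(ℝ, E) (fun y ↦ g y (X y) (J y (Y y))) x (Z x)
        - g x (VectorField.mlieBracket 𝓘(ℝ, E) X Y x) (J x (Z x))
        - g x (VectorField.mlieBracket 𝓘(ℝ, E) Y Z x) (J x (X x))
        - g x (VectorField.mlieBracket 𝓘(ℝ, E) Z X x) (J x (Y x)) = 0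

namespace PseudoKahler

variable (K : PseudoKahler E M)

/-- The Kähler form `Φ (X, Y) = g (X, J Y)`. -/
def Φ (x : M) (v w : TangentSpace 𝓘(ℝ, E) x) : ℝ := K.g x v (J x w)

/-- The metric, extended complex bilinearly. -/
def gCx (x : M) (Z W : TangentCx (E := E) x) : ℂ :=
  ⟨K.g x Z.re W.re - K.g x Z.im W.im, K.g x Z.re W.im + K.g x Z.im W.re⟩

/-- The Lie derivative `(L_H g) (Y, Z) = H (g (Y, Z)) - g ([H, Y], Z) - g (Y, [H, Z])`. -/
def lieDeriv (H Y Z : Π x : M, TangentCx (E := E) x) (x : M) : ℂ :=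
  derivCx (fun y ↦ K.gCx y (Y y) (Z y)) x (H x)
    - K.gCx x (bracketCx H Y x) (Z x) - K.gCx x (Y x) (bracketCx H Z x)

/-- `D` is the Levi-Civita connection: torsionfree and `D g = 0`. -/
def IsLeviCivita (D : Connection E M) : Prop :=
  D.IsTorsionFree ∧ D.Preserves fun x v w ↦ K.g x v w

end PseudoKahler

variable (E M) in
/-- A rigid special pseudo-Kähler manifold: a pseudo-Kähler manifold with a real, flat, torsionfree,
symplectic connection `∇` with `d_∇ J = 0`. -/
structure SpecialPseudoKahler extends PseudoKahler E M where
  /-- the flat connection -/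
  conn : Connection E M
  conn_smooth : CovariantDerivative.ContMDiffCovariantDerivative conn ∞
  flat : conn.IsFlat
  torsionFree : conn.IsTorsionFree
  symplectic : conn.Preserves toPseudoKahler.Φ
  /-- `(d_∇ J) (X, Y) = ∇_X (J Y) - ∇_Y (J X) - J [X, Y]` -/
  d_J : ∀ (X Y : Π x : M, TangentSpace 𝓘(ℝ, E) x) (x : M), VDiffAt X x → VDiffAt Y x →
    conn (fun y ↦ J y (Y y)) x (X x) - conn (fun y ↦ J y (X y)) x (Y x)
      - J x (VectorField.mlieBracket 𝓘(ℝ, E) X Y x) = 0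

/-- Special coordinates: holomorphic coordinates `η` on the open set `η.source`, and conjugate
holomorphic functions `lam j`, such that `x ^ j = Re η ^ j` and `y_j = - Re (lam j)` are flat Darboux
coordinates, `∇ dx ^ j = 0 = ∇ dy_j` and `Φ = ∑ dx ^ j ∧ dy_j`. -/
structure SpecialCoordinates (S : SpecialPseudoKahler E M) (n : ℕ) where
  /-- the coordinates -/
  η : OpenPartialHomeomorph M (Fin n → ℂ)
  holo : ContMDiffOn 𝓘(ℂ, E) 𝓘(ℂ, Fin n → ℂ) ω η η.source
  holo_symm : ContMDiffOn 𝓘(ℂ, Fin n → ℂ) 𝓘(ℂ, E) ω η.symm η.target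
  /-- the conjugate functions -/
  lam : Fin n → M → ℂ
  holo_lam : ∀ j, ContMDiffOn 𝓘(ℂ, E) 𝓘(ℂ, ℂ) ω (lam j) η.source
  affine_x : ∀ j, S.conn.IsAffineOn (fun p ↦ (η p j).re) η.source
  affine_y : ∀ j, S.conn.IsAffineOn (fun p ↦ -(lam j p).re) η.source
  darboux : ∀ p ∈ η.source, ∀ v w : TangentSpace 𝓘(ℝ, E) p, S.Φ p v w =
    ∑ j, (mvfderiv 𝓘(ℝ, E) (fun q ↦ (η q j).re) p v * mvfderiv 𝓘(ℝ, E) (fun q ↦ -(lam j q).re) p w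
      - mvfderiv 𝓘(ℝ, E) (fun q ↦ (η q j).re) p w * mvfderiv 𝓘(ℝ, E) (fun q ↦ -(lam j q).re) p v)

namespace SpecialCoordinates

variable {S : SpecialPseudoKahler E M} {n : ℕ} (C : SpecialCoordinates S n)

/-- The coordinate vector field `∂/∂η ^ α`. -/
def coordVec (α : Fin n) (p : M) : TangentCx (E := E) p :=
  toType10 p (mfderiv 𝓘(ℂ, Fin n → ℂ) 𝓘(ℂ, E) C.η.symm (C.η p) (Pi.single α (1 : ℂ)))

/-- `τ_{jk} = ∂(lam k)/∂η ^ j`, as a function of the coordinates. -/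
def τ (j k : Fin n) (z : Fin n → ℂ) : ℂ :=
  fderiv ℂ (fun z' ↦ C.lam k (C.η.symm z')) z (Pi.single j 1)

/-- `F` is a prepotential: a holomorphic function of the coordinates with
`lam j = -8 ∂F/∂η ^ j`. -/
def IsPrepotential (F : (Fin n → ℂ) → ℂ) : Prop :=
  ContDiffOn ℂ ω F C.η.target ∧
    ∀ z ∈ C.η.target, ∀ j, C.lam j (C.η.symm z) = -8 * fderiv ℂ F z (Pi.single j 1)

end SpecialCoordinates

/-- `f` is homogeneous of degree `k` on `Ω`: `f (l z) = l ^ k f z` for `z ∈ Ω` and every nonzero `l`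
in the path component of `1` in `{l ≠ 0 | l z ∈ Ω}` (so for every nonzero `l` if `Ω` is invariant
under multiplication by nonzero complex numbers). -/
def IsHomogeneousOn {n : ℕ} (f : (Fin n → ℂ) → ℂ) (Ω : Set (Fin n → ℂ)) (k : ℕ) : Prop :=
  ∀ z ∈ Ω, ∀ l : ℂ, JoinedIn {l' : ℂ | l' ≠ 0 ∧ l' • z ∈ Ω} 1 l → f (l • z) = l ^ k * f z

end Manifold

/-! ### The action of the multiplicative group -/

section Action

variable (E : Type*) [NormedAddCommGroup E] [NormedSpace ℂ E]
variable {M : Type*} [TopologicalSpace M] [ChartedSpace E M] [MulAction ℂˣ M]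

/-- `exp l`, as an element of the multiplicative group. -/
def expUnit (l : ℂ) : ℂˣ := Units.mk0 (Complex.exp l) (Complex.exp_ne_zero l)

/-- The holomorphic velocity `d/dl (exp l • x)` at `l = 0`. -/
def fundamentalVelocity (x : M) : TangentSpace 𝓘(ℂ, E) x :=
  mfderiv 𝓘(ℂ, ℂ) 𝓘(ℂ, E) (fun l : ℂ ↦ expUnit l • x) 0 (1 : ℂ)

/-- The fundamental vector field of the action, as a complex vector field of type `(1, 0)`. -/
def fundamentalField (x : M) : TangentCx (E := E) x := toType10 x (fundamentalVelocity E x)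

end Action

end

end SpecialKahler

open SpecialKahler

namespace SpecialKahler

open scoped Topology
open Filter Set

noncomputable section

/-! ### Real derivatives of holomorphic maps and real vector fields underlying complex ones. -/

section Restriction

variable {E : Type*} [NormedAddCommGroup E] [NormedSpace ℂ E]
variable {M : Type*} [TopologicalSpace M] [ChartedSpace E M]
variable {E' : Type*} [NormedAddCommGroup E'] [NormedSpace ℂ E']
variable {N : Type*} [TopologicalSpace N] [ChartedSpace E' N]

/-! Write `H = (T - i J T) / 2` with `T` the real field underlying the holomorphic velocity of the
action, and `c = a + i b`. Holomorphy gives `[T, J V] = J [T, V]` (`mlieBracket_J_right`). Combined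
with `d_∇ J = 0` and the absence of torsion this yields `∇_v (J T) = ∇_{J v} T`, so the hypothesis
on `H` becomes the real equation `∇_v T = (a + b J) v`, recorded in `IsInfinitesimalHomothety`; then
`J T` satisfies the same with `i c` in place of `c`.

As `g(A, B) = Φ(J A, B)` and `Φ` is parallel, these equations give `L_T g = 2 a g`, which is the
symmetric part of `g(D_v T, w)`. The skew part is the exterior derivative of `g(T, ·) = Φ(J T, ·)`,
and any torsionfree connection computes it. Both parts agree with those of `g((a + b J) v, w)`, so
nondegeneracy gives `D_v T = (a + b J) v`.

If `f` is holomorphic and `Re f` is affine for `∇`, then `d(H f) = c df`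
(`mvfderiv_sub_eq_zero_of_isAffineOn`), so `H f = c f + k` on a connected domain and `f + k / c` is
an eigenfunction. For `c ≠ 0` this normalizes all `η^j` and `λ_j`. Euler's relation then makes `λ_j`
homogeneous of degree 1 and `τ` of degree 0. Invariance of `Φ` under `J` kills `∑ dη^j ∧ dλ_j`, so
`τ` is symmetric and `-(1/16) ∑ η^j λ_j` is a prepotential of degree 2. -/

theorem hasMFDerivAt_real {f : M → N} {x : M} {f' : E →L[ℂ] E'}
    (h : HasMFDerivAt 𝓘(ℂ, E) 𝓘(ℂ, E') f x f') :
    HasMFDerivAt 𝓘(ℝ, E) 𝓘(ℝ, E') f x (f'.restrictScalars ℝ : E →L[ℝ] E') :=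
  ⟨h.1, h.2.restrictScalars ℝ⟩

theorem mdifferentiableAt_real {f : M → N} {x : M}
    (h : MDifferentiableAt 𝓘(ℂ, E) 𝓘(ℂ, E') f x) : MDifferentiableAt 𝓘(ℝ, E) 𝓘(ℝ, E') f x :=
  (hasMFDerivAt_real h.hasMFDerivAt).mdifferentiableAt

theorem mfderiv_real {f : M → N} {x : M} (h : MDifferentiableAt 𝓘(ℂ, E) 𝓘(ℂ, E') f x)
    (v : TangentSpace 𝓘(ℂ, E) x) :
    mfderiv 𝓘(ℝ, E) 𝓘(ℝ, E') f x (toReal x v)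
      = toReal (f x) (mfderiv 𝓘(ℂ, E) 𝓘(ℂ, E') f x v) :=
  congrArg (fun L : E →L[ℝ] E' ↦ L (v : E)) (hasMFDerivAt_real h.hasMFDerivAt).mfderiv

theorem mfderiv_real_J {f : M → N} {x : M} (h : MDifferentiableAt 𝓘(ℂ, E) 𝓘(ℂ, E') f x)
    (v : TangentSpace 𝓘(ℝ, E) x) :
    mfderiv 𝓘(ℝ, E) 𝓘(ℝ, E') f x (J x v) = J (f x) (mfderiv 𝓘(ℝ, E) 𝓘(ℝ, E') f x v) := by
  have key : ∀ (L : E →L[ℝ] E') (L' : E →L[ℂ] E') (w : E), (∀ u, L u = L' u) →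
      L (Complex.I • w) = Complex.I • L w := fun L L' w hL ↦ by rw [hL, hL, L'.map_smul]
  exact key (mfderiv 𝓘(ℝ, E) 𝓘(ℝ, E') f x) (mfderiv 𝓘(ℂ, E) 𝓘(ℂ, E') f x) v (mfderiv_real h)

theorem J_J (x : M) (v : TangentSpace 𝓘(ℝ, E) x) : J x (J x v) = -v := by
  have key : ∀ w : E, Complex.I • Complex.I • w = -w := fun w ↦ by
    rw [smul_smul, Complex.I_mul_I, neg_one_smul]
  exact key v

variable [IsManifold 𝓘(ℂ, E) ω M]

/-- Differentiability of a field is read in a trivialization, that is, after applying the derivative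
of a chart. Holomorphic charts have complex linear derivative, so the real and complex readings
agree, and `J` becomes multiplication by `i`. -/
theorem trivializationAt_snd_eq_mfderiv {x₀ x : M} (hx : x ∈ (chartAt E x₀).source)
    (v : TangentSpace 𝓘(ℝ, E) x) :
    (trivializationAt E (TangentSpace 𝓘(ℝ, E)) x₀ ⟨x, v⟩).2
      = mfderiv 𝓘(ℝ, E) 𝓘(ℝ, E) (extChartAt 𝓘(ℝ, E) x₀) x v := by
  refine Eq.trans ?_ (congrArg (fun L : E →L[ℝ] E ↦ L v)
    (TangentBundle.continuousLinearMapAt_trivializationAt hx))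
  change _ = (trivializationAt E (TangentSpace 𝓘(ℝ, E)) x₀).continuousLinearMapAt ℝ x v
  rw [Trivialization.continuousLinearMapAt_apply, Trivialization.linearMapAt_apply,
    if_pos (by simpa using hx)]

theorem trivializationAt_snd_eq_mfderiv_complex {x₀ x : M} (hx : x ∈ (chartAt E x₀).source)
    (v : TangentSpace 𝓘(ℂ, E) x) :
    (trivializationAt E (TangentSpace 𝓘(ℂ, E)) x₀ ⟨x, v⟩).2
      = mfderiv 𝓘(ℂ, E) 𝓘(ℂ, E) (extChartAt 𝓘(ℂ, E) x₀) x v := by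
  refine Eq.trans ?_ (congrArg (fun L : E →L[ℂ] E ↦ L v)
    (TangentBundle.continuousLinearMapAt_trivializationAt hx))
  change _ = (trivializationAt E (TangentSpace 𝓘(ℂ, E)) x₀).continuousLinearMapAt ℂ x v
  rw [Trivialization.continuousLinearMapAt_apply, Trivialization.linearMapAt_apply,
    if_pos (by simpa using hx)]

theorem mdifferentiableAt_extChartAt_complex {x₀ x : M} (hx : x ∈ (chartAt E x₀).source) :
    MDifferentiableAt 𝓘(ℂ, E) 𝓘(ℂ, E) (extChartAt 𝓘(ℂ, E) x₀) x :=
  mdifferentiableAt_extChartAt hx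

theorem vDiffAt_toReal {X : Π x : M, TangentSpace 𝓘(ℂ, E) x} {x : M}
    (h : MDifferentiableAt 𝓘(ℂ, E) (𝓘(ℂ, E).prod 𝓘(ℂ, E))
      (fun y ↦ (TotalSpace.mk' E y (X y) : TangentBundle 𝓘(ℂ, E) M)) x) :
    VDiffAt (fun y ↦ toReal y (X y)) x := by
  rw [mdifferentiableAt_section] at h
  rw [VDiffAt, mdifferentiableAt_section]
  refine (mdifferentiableAt_real h).congr_of_eventuallyEq ?_
  filter_upwards [(chartAt E x).open_source.mem_nhds (mem_chart_source E x)] with y hy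
  rw [trivializationAt_snd_eq_mfderiv hy, trivializationAt_snd_eq_mfderiv_complex hy]
  exact mfderiv_real (mdifferentiableAt_extChartAt_complex hy) (X y)

theorem VDiffAt.J {X : Π x : M, TangentSpace 𝓘(ℝ, E) x} {x : M} (h : VDiffAt X x) :
    VDiffAt (fun y ↦ J y (X y)) x := by
  rw [VDiffAt, mdifferentiableAt_section] at h ⊢
  have h1 : MDifferentiableAt 𝓘(ℝ, E) 𝓘(ℝ, E) (fun y ↦ (Complex.I • ContinuousLinearMap.id ℝ E)
      (trivializationAt E (TangentSpace 𝓘(ℝ, E)) x ⟨y, X y⟩).2) x :=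
    (ContinuousLinearMap.differentiableAt _).comp_mdifferentiableAt h
  refine h1.congr_of_eventuallyEq ?_
  filter_upwards [(chartAt E x).open_source.mem_nhds (mem_chart_source E x)] with y hy
  rw [trivializationAt_snd_eq_mfderiv hy, trivializationAt_snd_eq_mfderiv hy]
  exact mfderiv_real_J (mdifferentiableAt_extChartAt_complex hy) (X y)

end Restriction

/-! ### Lie brackets with a holomorphic field commute with `J`. -/

section Bracket

variable {E : Type*} [NormedAddCommGroup E] [NormedSpace ℂ E]
variable {F : Type*} [NormedAddCommGroup F] [NormedSpace ℂ F]

theorem inverse_apply_I_smul {L : E →L[ℝ] F} (hL : ∀ v, L (Complex.I • v) = Complex.I • L v)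
    (w : F) : L.inverse (Complex.I • w) = Complex.I • L.inverse w := by
  by_cases h : L.IsInvertible
  · obtain ⟨e, rfl⟩ := h
    rw [ContinuousLinearMap.inverse_equiv]
    apply e.injective
    have := hL (e.symm w)
    simp_all
  -- The inverse of a non-invertible map is `0` by convention, so both sides vanish.
  · simp [ContinuousLinearMap.inverse_of_not_isInvertible h]

theorem inverse_apply_eq_of_restrictScalars {L : E →L[ℝ] F} {L' : E →L[ℂ] F}
    (hL : ∀ v, L v = L' v) (h' : L'.IsInvertible) (w : F) : L.inverse w = L'.inverse w := by
  obtain ⟨e, rfl⟩ := h'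
  have : L.inverse = (e.symm : F →L[ℂ] E).restrictScalars ℝ :=
    ContinuousLinearMap.inverse_eq (by ext v; simp [hL]) (by ext v; simp [hL])
  rw [this, ContinuousLinearMap.inverse_equiv]
  rfl

/-- Both terms of the bracket are compatible with `i`: the derivative of `X` is complex linear, and
that of `i V` is `i` times that of `V`. Only `X` has to be holomorphic. -/
theorem lieBracket_I_smul_right {X V : E → E} {z : E} (hX : DifferentiableAt ℂ X z)
    (hV : DifferentiableAt ℝ V z) :
    VectorField.lieBracket ℝ X (fun y ↦ Complex.I • V y) z
      = Complex.I • VectorField.lieBracket ℝ X V z := by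
  have h1 : fderiv ℝ (fun y ↦ Complex.I • V y) z = Complex.I • fderiv ℝ V z :=
    fderiv_const_smul hV Complex.I
  have h2 : fderiv ℝ X z = (fderiv ℂ X z).restrictScalars ℝ := hX.fderiv_restrictScalars ℝ
  simp [VectorField.lieBracket, h1, h2, smul_sub]

variable {M : Type*} [TopologicalSpace M] [ChartedSpace E M]

/-- The representative of a real vector field in the preferred chart at `x`. -/
def chartField (x : M) (V : Π x : M, TangentSpace 𝓘(ℝ, E) x) : E → E := fun z ↦
  VectorField.mpullbackWithin 𝓘(ℝ, E) 𝓘(ℝ, E) (extChartAt 𝓘(ℝ, E) x).symm V (range 𝓘(ℝ, E)) z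

/-- The derivative at `x` of the preferred chart at `x`. -/
def chartDeriv (x : M) : E →L[ℝ] E := mfderiv 𝓘(ℝ, E) 𝓘(ℝ, E) (extChartAt 𝓘(ℝ, E) x) x

theorem mlieBracket_eq_lieBracket_chartField (X V : Π x : M, TangentSpace 𝓘(ℝ, E) x) (x : M) :
    VectorField.mlieBracket 𝓘(ℝ, E) X V x
      = (chartDeriv x).inverse
        (VectorField.lieBracket ℝ (chartField x X) (chartField x V) (extChartAt 𝓘(ℝ, E) x x)) := by
  rw [← VectorField.lieBracketWithin_univ]
  have h : ((extChartAt 𝓘(ℝ, E) x).symm ⁻¹' univ ∩ range 𝓘(ℝ, E)) = univ := by simp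
  have := VectorField.mlieBracketWithin_apply (I := 𝓘(ℝ, E)) (V := X) (W := V) (s := univ)
    (x₀ := x)
  rw [h] at this
  exact this

theorem extChartAt_target_mem_nhds_complex (x : M) :
    (extChartAt 𝓘(ℂ, E) x).target ∈ 𝓝 (extChartAt 𝓘(ℝ, E) x x) :=
  extChartAt_target_mem_nhds (I := 𝓘(ℂ, E)) x

variable [IsManifold 𝓘(ℂ, E) ω M]

theorem differentiableAt_chartField [CompleteSpace E] {V : Π x : M, TangentSpace 𝓘(ℝ, E) x} {x : M}
    (hV : VDiffAt V x) : DifferentiableAt ℝ (chartField x V) (extChartAt 𝓘(ℝ, E) x x) := by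
  have h := MDifferentiableWithinAt.differentiableWithinAt_mpullbackWithin_vectorField
    (s := univ) (mdifferentiableWithinAt_univ.2 hV)
  have h' : ((extChartAt 𝓘(ℝ, E) x).symm ⁻¹' univ ∩ range 𝓘(ℝ, E)) = univ := by simp
  rw [h'] at h
  exact differentiableWithinAt_univ.1 h

theorem mdifferentiableAt_extChartAt_symm_complex {x : M} {z : E}
    (hz : z ∈ (extChartAt 𝓘(ℂ, E) x).target) :
    MDifferentiableAt 𝓘(ℂ, E) 𝓘(ℂ, E) (extChartAt 𝓘(ℂ, E) x).symm z := by
  have := mdifferentiableWithinAt_extChartAt_symm (I := 𝓘(ℂ, E)) hz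
  rw [ModelWithCorners.range_eq_univ, mdifferentiableWithinAt_univ] at this
  exact this

theorem chartField_J {x : M} (V : Π x : M, TangentSpace 𝓘(ℝ, E) x) :
    chartField x (fun y ↦ J y (V y)) =ᶠ[𝓝 (extChartAt 𝓘(ℝ, E) x x)]
      fun z ↦ Complex.I • chartField x V z := by
  filter_upwards [extChartAt_target_mem_nhds_complex x] with z hz
  have hd := mdifferentiableAt_extChartAt_symm_complex hz
  have key : ∀ L : E →L[ℝ] E, L = mfderiv 𝓘(ℝ, E) 𝓘(ℝ, E) (extChartAt 𝓘(ℝ, E) x).symm z →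
      (∀ v, L (Complex.I • v) = Complex.I • L v) := by
    rintro L rfl
    exact mfderiv_real_J hd
  have h0 : mfderivWithin 𝓘(ℝ, E) 𝓘(ℝ, E) (extChartAt 𝓘(ℝ, E) x).symm (range 𝓘(ℝ, E)) z
      = mfderiv 𝓘(ℝ, E) 𝓘(ℝ, E) (extChartAt 𝓘(ℝ, E) x).symm z := by
    rw [ModelWithCorners.range_eq_univ, mfderivWithin_univ]
  exact inverse_apply_I_smul (key _ h0) (V ((extChartAt 𝓘(ℝ, E) x).symm z))

theorem differentiableAt_chartField_complex [CompleteSpace E]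
    {X : Π x : M, TangentSpace 𝓘(ℂ, E) x} {x : M}
    (h : MDifferentiableAt 𝓘(ℂ, E) (𝓘(ℂ, E).prod 𝓘(ℂ, E))
      (fun y ↦ (TotalSpace.mk' E y (X y) : TangentBundle 𝓘(ℂ, E) M)) x) :
    DifferentiableAt ℂ (chartField x (fun y ↦ toReal y (X y))) (extChartAt 𝓘(ℝ, E) x x) := by
  have h := MDifferentiableWithinAt.differentiableWithinAt_mpullbackWithin_vectorField
    (s := univ) (mdifferentiableWithinAt_univ.2 h)
  have h' : ((extChartAt 𝓘(ℂ, E) x).symm ⁻¹' univ ∩ range 𝓘(ℂ, E)) = univ := by simp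
  rw [h'] at h
  refine DifferentiableAt.congr_of_eventuallyEq (differentiableWithinAt_univ.1 h) ?_
  filter_upwards [extChartAt_target_mem_nhds_complex x] with z hz
  have hd := mdifferentiableAt_extChartAt_symm_complex hz
  have key : ∀ (L : E →L[ℝ] E) (L' : E →L[ℂ] E),
      L = mfderiv 𝓘(ℝ, E) 𝓘(ℝ, E) (extChartAt 𝓘(ℝ, E) x).symm z →
      L' = mfderiv 𝓘(ℂ, E) 𝓘(ℂ, E) (extChartAt 𝓘(ℂ, E) x).symm z → ∀ v, L v = L' v := by
    rintro L L' rfl rfl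
    exact mfderiv_real hd
  have h0 : mfderivWithin 𝓘(ℝ, E) 𝓘(ℝ, E) (extChartAt 𝓘(ℝ, E) x).symm (range 𝓘(ℝ, E)) z
      = mfderiv 𝓘(ℝ, E) 𝓘(ℝ, E) (extChartAt 𝓘(ℝ, E) x).symm z := by
    rw [ModelWithCorners.range_eq_univ, mfderivWithin_univ]
  have h1 : mfderivWithin 𝓘(ℂ, E) 𝓘(ℂ, E) (extChartAt 𝓘(ℂ, E) x).symm (range 𝓘(ℂ, E)) z
      = mfderiv 𝓘(ℂ, E) 𝓘(ℂ, E) (extChartAt 𝓘(ℂ, E) x).symm z := by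
    rw [ModelWithCorners.range_eq_univ, mfderivWithin_univ]
  exact inverse_apply_eq_of_restrictScalars (key _ _ h0 h1)
    (isInvertible_mfderivWithin_extChartAt_symm hz) (X ((extChartAt 𝓘(ℂ, E) x).symm z))

/-- A holomorphic vector field preserves the complex structure. -/
theorem mlieBracket_J_right [CompleteSpace E]
    {X : Π x : M, TangentSpace 𝓘(ℂ, E) x} {V : Π x : M, TangentSpace 𝓘(ℝ, E) x} {x : M}
    (h : MDifferentiableAt 𝓘(ℂ, E) (𝓘(ℂ, E).prod 𝓘(ℂ, E))
      (fun y ↦ (TotalSpace.mk' E y (X y) : TangentBundle 𝓘(ℂ, E) M)) x) (hV : VDiffAt V x) :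
    VectorField.mlieBracket 𝓘(ℝ, E) (fun y ↦ toReal y (X y)) (fun y ↦ J y (V y)) x
      = J x (VectorField.mlieBracket 𝓘(ℝ, E) (fun y ↦ toReal y (X y)) V x) := by
  rw [mlieBracket_eq_lieBracket_chartField, mlieBracket_eq_lieBracket_chartField,
    (EventuallyEq.refl _ _).lieBracket_vectorField_eq (chartField_J V),
    lieBracket_I_smul_right (differentiableAt_chartField_complex h)
      (differentiableAt_chartField hV)]
  have key : ∀ v, (chartDeriv x : E →L[ℝ] E) (Complex.I • v) = Complex.I • chartDeriv x v :=
    mfderiv_real_J (mdifferentiableAt_extChartAt_complex (mem_chart_source E x))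
  exact inverse_apply_I_smul key _

end Bracket

/-! ### The fundamental vector field and its holomorphy. -/

section FundamentalField

theorem contMDiff_expUnit : ContMDiff 𝓘(ℂ, ℂ) 𝓘(ℂ, ℂ) ω expUnit :=
  ContMDiff.of_comp_isOpenEmbedding Units.isOpenEmbedding_val
    (contMDiff_iff_contDiff.2 Complex.contDiff_exp)

theorem expUnit_zero : expUnit 0 = 1 := Units.ext Complex.exp_zero

theorem expUnit_add (l m : ℂ) : expUnit (l + m) = expUnit l * expUnit m :=
  Units.ext (Complex.exp_add l m)

variable {E : Type*} [NormedAddCommGroup E] [NormedSpace ℂ E]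
variable {M : Type*} [TopologicalSpace M] [ChartedSpace E M] 
theorem isType10_iff (x : M) (Z : TangentCx (E := E) x) : IsType10 x Z ↔ Z.im = -J x Z.re := by
  constructor
  · intro h
    have := congrArg Cx.re h
    simp [JCx] at this
    rw [this, neg_neg]
  · intro h
    rw [IsType10]
    ext <;> simp [JCx, h, J_J]

variable [MulAction ℂˣ M]

theorem fundamentalField_re (x : M) :
    (fundamentalField E x).re = (1 / 2 : ℝ) • toReal x (fundamentalVelocity E x) := by
  have h : (1 / 2 : ℂ).re = 1 / 2 ∧ (1 / 2 : ℂ).im = 0 := by norm_num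
  simp [fundamentalField, toType10, -one_div, h]

theorem fundamentalField_im (x : M) :
    (fundamentalField E x).im = -((1 / 2 : ℝ) • J x (toReal x (fundamentalVelocity E x))) := by
  have h : (1 / 2 : ℂ).re = 1 / 2 ∧ (1 / 2 : ℂ).im = 0 := by norm_num
  simp [fundamentalField, toType10, -one_div, h]

theorem isType10_fundamentalField (x : M) : IsType10 x (fundamentalField E x) := by
  rw [isType10_iff, fundamentalField_re, fundamentalField_im, map_smul]

variable [ContMDiffSMul 𝓘(ℂ, ℂ) 𝓘(ℂ, E) ω ℂˣ M]

theorem contMDiff_expUnit_smul :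
    ContMDiff (𝓘(ℂ, ℂ).prod 𝓘(ℂ, E)) 𝓘(ℂ, E) ω (fun p : ℂ × M ↦ expUnit p.1 • p.2) :=
  (contMDiff_smul (I := 𝓘(ℂ, ℂ)) (I' := 𝓘(ℂ, E)) (n := ω) (G := ℂˣ) (M := M)).comp
    ((contMDiff_expUnit.comp contMDiff_fst).prodMk contMDiff_snd)

theorem contMDiff_orbit (x : M) : ContMDiff 𝓘(ℂ, ℂ) 𝓘(ℂ, E) ω (fun l : ℂ ↦ expUnit l • x) :=
  contMDiff_expUnit_smul.comp (contMDiff_id.prodMk contMDiff_const)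

theorem mdifferentiable_orbit (x : M) :
    MDifferentiable 𝓘(ℂ, ℂ) 𝓘(ℂ, E) (fun l : ℂ ↦ expUnit l • x) :=
  (contMDiff_orbit x).mdifferentiable (by simp)

variable [IsManifold 𝓘(ℂ, E) ω M]

/-- The velocity at `x` is the value of the tangent map of `(l, x) ↦ exp l • x` on the vector `(1,
0)` over `(0, x)`, hence a composition of analytic maps. -/
theorem contMDiff_fundamentalVelocity :
    ContMDiff 𝓘(ℂ, E) (𝓘(ℂ, E).prod 𝓘(ℂ, E)) ω
      (fun x : M ↦ (TotalSpace.mk' E x (fundamentalVelocity E x) : TangentBundle 𝓘(ℂ, E) M)) := by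
  let fg : M → TangentBundle 𝓘(ℂ, E) M := fun g ↦ TotalSpace.mk' E g 0
  have sfg : ContMDiff 𝓘(ℂ, E) (𝓘(ℂ, E).prod 𝓘(ℂ, E)) ω fg := contMDiff_zeroSection _ _
  let fv : M → TangentBundle 𝓘(ℂ, ℂ) ℂ := fun _ ↦ TotalSpace.mk' ℂ 0 (1 : ℂ)
  have sfv : ContMDiff 𝓘(ℂ, E) (𝓘(ℂ, ℂ).prod 𝓘(ℂ, ℂ)) ω fv := contMDiff_const
  have S₂ := contMDiff_equivTangentBundleProd_symm (I := 𝓘(ℂ, ℂ)) (M := ℂ) (I' := 𝓘(ℂ, E))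
    (M' := M) (n := ω)
  have S₃ := ContMDiff.contMDiff_tangentMap (m := ω) (n := ω)
    (contMDiff_expUnit_smul (E := E) (M := M)) le_rfl
  have S := (S₃.comp S₂).comp (sfv.prodMk sfg)
  refine S.congr fun x ↦ ?_
  have h : tangentMap 𝓘(ℂ, ℂ) 𝓘(ℂ, E) (fun l : ℂ ↦ expUnit l • x) ⟨0, (1 : ℂ)⟩
      = tangentMap (𝓘(ℂ, ℂ).prod 𝓘(ℂ, E)) 𝓘(ℂ, E) (fun p : ℂ × M ↦ expUnit p.1 • p.2)
        (tangentMap 𝓘(ℂ, ℂ) (𝓘(ℂ, ℂ).prod 𝓘(ℂ, E)) (fun l : ℂ ↦ (l, x)) ⟨0, (1 : ℂ)⟩) :=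
    tangentMap_comp_at (g := fun p : ℂ × M ↦ expUnit p.1 • p.2) (f := fun l : ℂ ↦ (l, x))
      ⟨0, (1 : ℂ)⟩ (contMDiff_expUnit_smul.mdifferentiableAt (by simp))
      (mdifferentiableAt_id.prodMk mdifferentiableAt_const)
  rw [tangentMap_prod_left] at h
  -- The tangent map lands over `expUnit 0 • x`, which equals `x` only propositionally; all tangent
  -- spaces are `E`, so the vector is carried over unchanged.
  have key : ∀ (a b : M) (v : E), a = b →
      (TotalSpace.mk' E a v : TangentBundle 𝓘(ℂ, E) M) = TotalSpace.mk' E b v := by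
    rintro a b v rfl; rfl
  exact (key _ _ _ (by change x = expUnit 0 • x; rw [expUnit_zero, one_smul])).trans h

end FundamentalField

/-! ### Real homothetic fields: the metric and the Levi-Civita connection. -/

section Homothety

variable {E : Type*} [NormedAddCommGroup E] [NormedSpace ℂ E]
variable {M : Type*} [TopologicalSpace M] [ChartedSpace E M] [IsManifold 𝓘(ℂ, E) ω M]

/-- Torsion and parallelism are stated for fields; extending vectors turns these identities into
pointwise ones. -/
theorem exists_vDiffAt_extension {x : M} (v : TangentSpace 𝓘(ℝ, E) x) :
    ∃ V : Π x : M, TangentSpace 𝓘(ℝ, E) x, VDiffAt V x ∧ V x = v :=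
  ⟨FiberBundle.extend E v, FiberBundle.mdifferentiableAt_extend 𝓘(ℝ, E) E v,
    FiberBundle.extend_apply_self E v⟩

theorem Connection.const_smul (D : Connection E M) {V : Π x : M, TangentSpace 𝓘(ℝ, E) x} {x : M}
    (h : VDiffAt V x) (a : ℝ) (v : TangentSpace 𝓘(ℝ, E) x) :
    D (fun y ↦ a • V y) x v = a • D V x v :=
  congrArg (fun L : TangentSpace 𝓘(ℝ, E) x →L[ℝ] TangentSpace 𝓘(ℝ, E) x ↦ L v)
    (D.isCovariantDerivativeOnUniv.smul_const a h)

theorem Connection.neg (D : Connection E M) {V : Π x : M, TangentSpace 𝓘(ℝ, E) x} {x : M}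
    (h : VDiffAt V x) (v : TangentSpace 𝓘(ℝ, E) x) :
    D (fun y ↦ -V y) x v = -D V x v := by
  have := D.const_smul h (-1) v
  simpa only [neg_one_smul] using this

theorem mlieBracket_const_smul [CompleteSpace E] {V W : Π x : M, TangentSpace 𝓘(ℝ, E) x} {x : M}
    (h : VDiffAt V x) (a : ℝ) :
    VectorField.mlieBracket 𝓘(ℝ, E) (fun y ↦ a • V y) W x
      = a • VectorField.mlieBracket 𝓘(ℝ, E) V W x :=
  VectorField.mlieBracket_const_smul_left h

theorem PseudoKahler.mdifferentiableAt_g (K : PseudoKahler E M)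
    {A B : Π x : M, TangentSpace 𝓘(ℝ, E) x} {x : M} (hA : VDiffAt A x) (hB : VDiffAt B x) :
    MDifferentiableAt 𝓘(ℝ, E) 𝓘(ℝ, ℝ) (fun y ↦ K.g y (A y) (B y)) x := by
  have : MDifferentiableAt 𝓘(ℝ, E) (𝓘(ℝ, E).prod 𝓘(ℝ))
      (fun m ↦ TotalSpace.mk' ℝ (E := Bundle.Trivial M ℝ) m (K.g m (A m) (B m))) x := by
    apply MDifferentiableAt.clm_bundle_apply₂ (F₁ := E) (F₂ := E)
    · exact K.smooth.mdifferentiableAt (by simp)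
    · exact hA
    · exact hB
  rw [mdifferentiableAt_totalSpace] at this
  exact this.2

namespace PseudoKahler

variable (K : PseudoKahler E M)

theorem g_J_left (x : M) (v w : TangentSpace 𝓘(ℝ, E) x) : K.g x (J x v) w = -K.g x v (J x w) := by
  rw [← K.hermitian x v (J x w), J_J, map_neg, neg_neg]

theorem g_eq_Φ (x : M) (v w : TangentSpace 𝓘(ℝ, E) x) : K.g x v w = K.Φ x (J x v) w :=
  (K.hermitian x v w).symm

end PseudoKahler

/-- The real vector field `T` generates holomorphic homotheties at `x`: it preserves the complex
structure, and `∇_v T = (a + b J) v`, `∇_v (J T) = (a + b J) J v`. -/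
structure IsInfinitesimalHomothety (S : SpecialPseudoKahler E M)
    (T : Π x : M, TangentSpace 𝓘(ℝ, E) x) (a b : ℝ) (x : M) : Prop where
  diff : VDiffAt T x
  conn_eq : ∀ v, S.conn T x v = a • v + b • J x v
  conn_J : ∀ v, S.conn (fun y ↦ J y (T y)) x v = a • J x v - b • v
  bracket_J : ∀ V, VDiffAt V x → VectorField.mlieBracket 𝓘(ℝ, E) T (fun y ↦ J y (V y)) x
    = J x (VectorField.mlieBracket 𝓘(ℝ, E) T V x)

namespace IsInfinitesimalHomothety

variable {S : SpecialPseudoKahler E M} {T : Π x : M, TangentSpace 𝓘(ℝ, E) x} {a b : ℝ} {x : M}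

/-- The Lie derivative of the metric. -/
theorem lieDeriv_g (h : IsInfinitesimalHomothety S T a b x)
    {A B : Π x : M, TangentSpace 𝓘(ℝ, E) x} (hA : VDiffAt A x) (hB : VDiffAt B x) :
    mvfderiv 𝓘(ℝ, E) (fun y ↦ S.g y (A y) (B y)) x (T x)
      = S.g x (VectorField.mlieBracket 𝓘(ℝ, E) T A x) (B x)
        + S.g x (A x) (VectorField.mlieBracket 𝓘(ℝ, E) T B x) + 2 * a * S.g x (A x) (B x) := by
  -- It is `Φ`, not `g`, that is parallel, so `g(A, B)` is differentiated as `Φ(J A, B)`. The two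
  -- terms with `b` are `-b Φ(A, B)` and `b Φ(J A, J B)`, which cancel.
  have h1 := S.symplectic _ _ x hA.J hB (T x)
  have h2 := S.torsionFree _ _ x h.diff hA.J
  have h3 := S.torsionFree _ _ x h.diff hB
  rw [h.bracket_J A hA, h.conn_eq, sub_eq_iff_eq_add] at h2
  rw [h.conn_eq, sub_eq_iff_eq_add] at h3
  simp only [← PseudoKahler.g_eq_Φ] at h1
  rw [h1, h2, h3]
  simp only [PseudoKahler.Φ, map_add, map_smul, J_J, map_neg, PseudoKahler.g_J_left, add_apply,
    smul_apply, neg_apply, smul_eq_mul]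
  ring

/-- A Koszul-type argument: `lieDeriv_g` fixes the part of `g(D_v T, w)` symmetric in `v, w`. The
skew part is `d(g(T, ·))(v, w)`, computed a second time from `g(T, ·) = Φ(J T, ·)` and the flat
connection. -/
theorem g_leviCivita (h : IsInfinitesimalHomothety S T a b x) {D : Connection E M}
    (hD : S.IsLeviCivita D) (v w : TangentSpace 𝓘(ℝ, E) x) :
    S.g x (D T x v) w = S.g x (a • v + b • J x v) w := by
  obtain ⟨V, hV, rfl⟩ := exists_vDiffAt_extension v
  obtain ⟨W, hW, rfl⟩ := exists_vDiffAt_extension w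
  have hT := h.diff
  have e1 := hD.2 _ _ x hT hW (V x)
  have e2 := hD.2 _ _ x hV hW (T x)
  have e3 := hD.2 _ _ x hT hV (W x)
  have t1 := hD.1 _ _ x hT hV
  have t2 := hD.1 _ _ x hV hW
  have t3 := hD.1 _ _ x hT hW
  have l := h.lieDeriv_g hV hW
  have f1 := S.symplectic _ _ x hT.J hW (V x)
  have f2 := S.symplectic _ _ x hT.J hV (W x)
  have s := S.torsionFree _ _ x hV hW
  simp only [← PseudoKahler.g_eq_Φ, h.conn_J] at f1 f2
  rw [e2, ← t1, ← t3] at l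
  rw [e1] at f1
  rw [e3] at f2
  -- Both differences equal `[V, W]`, so the derivatives of `V` and `W` drop out when the two
  -- expressions for the exterior derivative are compared.
  have q : S.g x (T x) (D W x (V x) - D V x (W x))
      = S.g x (T x) (S.conn W x (V x) - S.conn V x (W x)) := by rw [t2, s]
  have sy1 := S.symm x (D T x (W x)) (V x)
  have sy2 := S.symm x (V x) (W x)
  simp only [PseudoKahler.Φ, map_add, map_sub, map_smul, J_J, map_neg, PseudoKahler.g_J_left,
    add_apply, smul_apply, sub_apply, smul_eq_mul] at *
  have sy3 := S.symm x (V x) (J x (W x))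
  rw [PseudoKahler.g_J_left] at sy3
  linear_combination (1/2) * (f1 - f2 + l - q + sy1 + a * sy2 + b * sy3)

/-- The covariant derivative for the Levi-Civita connection. -/
theorem leviCivita (h : IsInfinitesimalHomothety S T a b x) {D : Connection E M}
    (hD : S.IsLeviCivita D) (v : TangentSpace 𝓘(ℝ, E) x) : D T x v = a • v + b • J x v := by
  rw [← sub_eq_zero]
  refine S.nondegenerate x _ fun w ↦ ?_
  rw [map_sub, sub_apply, h.g_leviCivita hD, sub_self]

/-- The new constants come from `i (a + i b) = -b + i a`. That `J T` preserves `J` follows from `d_∇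
J = 0`, since `∇_{J V} (J T) = -∇_V T`. -/
protected theorem J (h : IsInfinitesimalHomothety S T a b x) :
    IsInfinitesimalHomothety S (fun y ↦ J y (T y)) (-b) a x where
  diff := h.diff.J
  conn_eq v := by rw [h.conn_J]; module
  conn_J v := by
    have : (fun y ↦ J y (J y (T y))) = fun y ↦ -T y := by ext1 y; exact J_J y _
    rw [this, S.conn.neg h.diff, h.conn_eq]
    module
  bracket_J V hV := by
    have h1 := S.d_J _ _ x h.diff.J hV
    have h2 := S.torsionFree _ _ x h.diff.J hV.J
    have : (fun y ↦ J y (J y (T y))) = fun y ↦ -T y := by ext1 y; exact J_J y _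
    rw [this, S.conn.neg h.diff, sub_eq_zero] at h1
    rw [← h1, ← h2, h.conn_J, h.conn_eq, J_J]
    module

end IsInfinitesimalHomothety

/-- Subtracting the torsion identity for `T, J V` from `d_∇ J = 0` for `T, V` gives `∇_V (J T) =
∇_{J V} T`. Hence the left side of `hre` is `2 ∇_v T`. -/
theorem isInfinitesimalHomothety_of_conn_cx [CompleteSpace E] (S : SpecialPseudoKahler E M)
    {X : Π x : M, TangentSpace 𝓘(ℂ, E) x} {x : M}
    (hX : MDifferentiableAt 𝓘(ℂ, E) (𝓘(ℂ, E).prod 𝓘(ℂ, E))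
      (fun y ↦ (TotalSpace.mk' E y (X y) : TangentBundle 𝓘(ℂ, E) M)) x) {c : ℂ}
    (hre : ∀ v, S.conn (fun y ↦ toReal y (X y)) x v
      - S.conn (fun y ↦ J y (toReal y (X y))) x (J x v) = (2 : ℝ) • (c.re • v + c.im • J x v)) :
    IsInfinitesimalHomothety S (fun y ↦ toReal y (X y)) c.re c.im x := by
  have hT : VDiffAt (fun y ↦ toReal y (X y)) x := vDiffAt_toReal hX
  have hbr := fun V (hV : VDiffAt V x) ↦ mlieBracket_J_right hX hV
  have hJ : ∀ v, S.conn (fun y ↦ J y (toReal y (X y))) x v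
      = S.conn (fun y ↦ toReal y (X y)) x (J x v) := fun v ↦ by
    obtain ⟨V, hV, rfl⟩ := exists_vDiffAt_extension v
    have h1 := S.d_J _ _ x hT hV
    have h2 := S.torsionFree _ _ x hT hV.J
    rw [hbr V hV] at h2
    rw [← h2] at h1
    rw [← sub_eq_zero, ← neg_eq_zero, ← h1]
    abel
  have hX' : ∀ v, S.conn (fun y ↦ toReal y (X y)) x v = c.re • v + c.im • J x v := fun v ↦ by
    have := hre v
    rw [hJ, J_J, map_neg, sub_neg_eq_add, ← two_smul ℝ] at this
    exact smul_right_injective _ (two_ne_zero' ℝ) this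
  refine ⟨hT, hX', fun v ↦ ?_, hbr⟩
  rw [hJ, hX', J_J]
  module

end Homothety

/-! ### From the real equations back to the complex field `H`. -/

section Complexification

variable {E : Type*} [NormedAddCommGroup E] [NormedSpace ℂ E]
variable {M : Type*} [TopologicalSpace M] [ChartedSpace E M]

theorem mvfderiv_clm_comp {F G : Type*} [NormedAddCommGroup F] [NormedSpace ℝ F]
    [NormedAddCommGroup G] [NormedSpace ℝ G] (L : F →L[ℝ] G) {f : M → F} {x : M}
    (hf : MDifferentiableAt 𝓘(ℝ, E) 𝓘(ℝ, F) f x) (v : TangentSpace 𝓘(ℝ, E) x) :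
    mvfderiv 𝓘(ℝ, E) (fun y ↦ L (f y)) x v = L (mvfderiv 𝓘(ℝ, E) f x v) :=
  congrArg (fun A : E →L[ℝ] G ↦ A v)
    ((L.hasFDerivAt (x := f x)).hasMFDerivAt.comp x hf.hasMFDerivAt).mfderiv

theorem mvfderiv_complex_mk {f g : M → ℝ} {x : M}
    (hf : MDifferentiableAt 𝓘(ℝ, E) 𝓘(ℝ, ℝ) f x) (hg : MDifferentiableAt 𝓘(ℝ, E) 𝓘(ℝ, ℝ) g x)
    (v : TangentSpace 𝓘(ℝ, E) x) :
    mvfderiv 𝓘(ℝ, E) (fun y ↦ (⟨f y, g y⟩ : ℂ)) x v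
      = ⟨mvfderiv 𝓘(ℝ, E) f x v, mvfderiv 𝓘(ℝ, E) g x v⟩ := by
  have h : MDifferentiableAt 𝓘(ℝ, E) 𝓘(ℝ, ℂ) (fun y ↦ (⟨f y, g y⟩ : ℂ)) x :=
    DifferentiableAt.comp_mdifferentiableAt (g := fun p : ℝ × ℝ ↦ Complex.equivRealProdCLM.symm p)
      (f := fun y ↦ (f y, g y)) Complex.equivRealProdCLM.symm.differentiableAt (hf.prodMk_space hg)
  exact Complex.ext (mvfderiv_clm_comp Complex.reCLM h v).symm
    (mvfderiv_clm_comp Complex.imCLM h v).symm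

section FundamentalFieldParts

variable [MulAction ℂˣ M]

theorem fundamentalField_re_eq : (fun x : M ↦ (fundamentalField E x).re)
    = fun x ↦ (1 / 2 : ℝ) • toReal x (fundamentalVelocity E x) :=
  funext fundamentalField_re

theorem fundamentalField_im_eq : (fun x : M ↦ (fundamentalField E x).im)
    = fun x ↦ (-(1 / 2) : ℝ) • J x (toReal x (fundamentalVelocity E x)) :=
  funext fun x ↦ by rw [fundamentalField_im, neg_smul]

end FundamentalFieldParts

variable [IsManifold 𝓘(ℂ, E) ω M]

theorem mvfderiv_gCx (K : PseudoKahler E M) {Y Z : Π x : M, TangentCx (E := E) x} {x : M}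
    (hY : VDiffAt (fun y ↦ (Y y).re) x) (hY' : VDiffAt (fun y ↦ (Y y).im) x)
    (hZ : VDiffAt (fun y ↦ (Z y).re) x) (hZ' : VDiffAt (fun y ↦ (Z y).im) x)
    (v : TangentSpace 𝓘(ℝ, E) x) :
    mvfderiv 𝓘(ℝ, E) (fun y ↦ K.gCx y (Y y) (Z y)) x v =
      ⟨mvfderiv 𝓘(ℝ, E) (fun y ↦ K.g y (Y y).re (Z y).re) x v
        - mvfderiv 𝓘(ℝ, E) (fun y ↦ K.g y (Y y).im (Z y).im) x v,
      mvfderiv 𝓘(ℝ, E) (fun y ↦ K.g y (Y y).re (Z y).im) x v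
        + mvfderiv 𝓘(ℝ, E) (fun y ↦ K.g y (Y y).im (Z y).re) x v⟩ := by
  have h1 := K.mdifferentiableAt_g hY hZ
  have h2 := K.mdifferentiableAt_g hY' hZ'
  have h3 := K.mdifferentiableAt_g hY hZ'
  have h4 := K.mdifferentiableAt_g hY' hZ
  rw [← sub_apply, ← add_apply, ← mvfderiv_fun_sub h1 h2, ← mvfderiv_fun_add h3 h4]
  exact mvfderiv_complex_mk (h1.sub h2) (h3.add h4) v

variable [MulAction ℂˣ M]

theorem Connection.cx_fundamentalField (D : Connection E M) {x : M}
    (hT : VDiffAt (fun y ↦ toReal y (fundamentalVelocity E y)) x) (Z : TangentCx (E := E) x) :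
    D.cx (fundamentalField E) x Z = (1 / 2 : ℂ) •
      Cx.mk (D (fun y ↦ toReal y (fundamentalVelocity E y)) x Z.re
          + D (fun y ↦ J y (toReal y (fundamentalVelocity E y))) x Z.im)
        (D (fun y ↦ toReal y (fundamentalVelocity E y)) x Z.im
          - D (fun y ↦ J y (toReal y (fundamentalVelocity E y))) x Z.re) := by
  have h : (1 / 2 : ℂ).re = 1 / 2 ∧ (1 / 2 : ℂ).im = 0 := by norm_num
  rw [Connection.cx, fundamentalField_re_eq, fundamentalField_im_eq]
  simp only [D.const_smul hT, D.const_smul hT.J]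
  ext
  · simp only [Cx.re_mk, Cx.re_smul, Cx.im_mk, h]; module
  · simp only [Cx.im_mk, Cx.im_smul, Cx.re_mk, h]; module

/-- If `∇_Y H = c Y` for the flat connection, then `D_Y H = c Y` for the Levi-Civita connection. -/
theorem cx_leviCivita_fundamentalField [CompleteSpace E]
    {S : SpecialPseudoKahler E M} {c : ℂ} {x : M}
    (h : IsInfinitesimalHomothety S (fun y ↦ toReal y (fundamentalVelocity E y)) c.re c.im x)
    {D : Connection E M} (hD : S.IsLeviCivita D) {Y : TangentCx (E := E) x} (hY : IsType10 x Y) :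
    D.cx (fundamentalField E) x Y = c • Y := by
  have h2 : (1 / 2 : ℂ).re = 1 / 2 ∧ (1 / 2 : ℂ).im = 0 := by norm_num
  rw [isType10_iff] at hY
  rw [D.cx_fundamentalField h.diff]
  ext
  · simp only [Cx.re_smul, Cx.re_mk, Cx.im_mk, h2, h.leviCivita hD, h.J.leviCivita hD, hY, map_neg,
      J_J]
    module
  · simp only [Cx.im_smul, Cx.re_mk, Cx.im_mk, h2, h.leviCivita hD, h.J.leviCivita hD, hY, map_neg,
      J_J]
    module

/-- The Lie derivative of the metric along the fundamental field. -/
theorem lieDeriv_fundamentalField [CompleteSpace E]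
    {S : SpecialPseudoKahler E M} {c : ℂ} {x : M}
    (h : IsInfinitesimalHomothety S (fun y ↦ toReal y (fundamentalVelocity E y)) c.re c.im x)
    {Y Z : Π x : M, TangentCx (E := E) x}
    (hY : VDiffAt (fun y ↦ (Y y).re) x) (hY' : VDiffAt (fun y ↦ (Y y).im) x)
    (hZ : VDiffAt (fun y ↦ (Z y).re) x) (hZ' : VDiffAt (fun y ↦ (Z y).im) x) :
    S.lieDeriv (fundamentalField E) Y Z x = c * S.gCx x (Y x) (Z x) := by
  rw [PseudoKahler.lieDeriv, derivCx]
  simp only [bracketCx, fundamentalField_re_eq, fundamentalField_im_eq,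
    mlieBracket_const_smul h.diff, mlieBracket_const_smul h.diff.J, mvfderiv_gCx _ hY hY' hZ hZ']
  simp only [fundamentalField_re, fundamentalField_im, map_smul, map_neg,
    h.lieDeriv_g hY hZ, h.lieDeriv_g hY hZ', h.lieDeriv_g hY' hZ, h.lieDeriv_g hY' hZ',
    h.J.lieDeriv_g hY hZ, h.J.lieDeriv_g hY hZ', h.J.lieDeriv_g hY' hZ, h.J.lieDeriv_g hY' hZ']
  apply Complex.ext <;>
  · simp [PseudoKahler.gCx]
    ring

variable [ContMDiffSMul 𝓘(ℂ, ℂ) 𝓘(ℂ, E) ω ℂˣ M]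

theorem vDiffAt_fundamentalVelocity (x : M) :
    VDiffAt (fun y ↦ toReal y (fundamentalVelocity E y)) x :=
  vDiffAt_toReal (contMDiff_fundamentalVelocity.mdifferentiableAt (by simp))

theorem isInfinitesimalHomothety_fundamentalVelocity [CompleteSpace E]
    (S : SpecialPseudoKahler E M) {c : ℂ} {x : M}
    (hH : ∀ Y : TangentCx (E := E) x, IsType10 x Y → S.conn.cx (fundamentalField E) x Y = c • Y) :
    IsInfinitesimalHomothety S (fun y ↦ toReal y (fundamentalVelocity E y)) c.re c.im x := by
  refine isInfinitesimalHomothety_of_conn_cx S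
    (contMDiff_fundamentalVelocity.mdifferentiableAt (by simp)) fun v ↦ ?_
  have h : (1 / 2 : ℂ).re = 1 / 2 ∧ (1 / 2 : ℂ).im = 0 := by norm_num
  -- Testing on the type `(1, 0)` vector `v - i J v` and taking real parts retains all the
  -- information needed.
  have := congrArg Cx.re (hH (Cx.mk v (-J x v)) ((isType10_iff _ _).2 rfl))
  rw [S.conn.cx_fundamentalField (vDiffAt_fundamentalVelocity x)] at this
  simp only [Cx.re_smul, Cx.re_mk, Cx.im_mk, h, map_neg] at this
  have h2 := congrArg (fun u ↦ (2 : ℝ) • u) this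
  refine Eq.trans ?_ (h2.trans ?_) <;> module

end Complexification

/-! ### Euler's relation, homogeneity and prepotentials on open subsets of `ℂ^n`. -/

section Calculus

/-- `W` need not be connected, but path components of an open set are open and connected; this is
why homogeneity is confined to a path component. -/
theorem eq_of_joinedIn_of_hasDerivAt_zero {φ : ℂ → ℂ} {W : Set ℂ} (hW : IsOpen W)
    (hφ : ∀ l ∈ W, HasDerivAt φ 0 l) {a b : ℂ} (hab : JoinedIn W a b) : φ b = φ a := by
  have ha := hab.source_mem
  have hsub : pathComponentIn W a ⊆ W := pathComponentIn_subset
  exact (hW.pathComponentIn a).is_const_of_fderiv_eq_zero (𝕜 := ℂ)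
    (isPathConnected_pathComponentIn ha).isConnected.isPreconnected
    (fun l hl ↦ (hφ l (hsub hl)).differentiableAt.differentiableWithinAt)
    (fun l hl ↦ by
      simpa using (hφ l (hsub hl)).hasFDerivAt.fderiv) hab (mem_pathComponentIn_self ha)

variable {n : ℕ} {Ω : Set (Fin n → ℂ)}

/-- Euler's relation implies homogeneity. -/
theorem isHomogeneousOn_of_euler (hΩ : IsOpen Ω) {f : (Fin n → ℂ) → ℂ} (hf : DifferentiableOn ℂ f Ω)
    {k : ℕ} (he : ∀ z ∈ Ω, fderiv ℂ f z z = k * f z) : IsHomogeneousOn f Ω k := by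
  intro z _ l hl
  have hW : IsOpen {l' : ℂ | l' ≠ 0 ∧ l' • z ∈ Ω} :=
    isOpen_ne.inter (hΩ.preimage (continuous_id.smul continuous_const))
  have hl0 := hl.target_mem.1
  -- Euler's relation at `m z` says exactly that `m ↦ f(m z) m^{-k}` has derivative zero.
  have key := eq_of_joinedIn_of_hasDerivAt_zero (φ := fun m ↦ f (m • z) * (m ^ k)⁻¹) hW
    (fun m hm ↦ ?_) hl
  · simp only [one_smul, one_pow, inv_one, mul_one] at key
    rw [← key]
    field_simp
  · have hm0 : m ≠ 0 := hm.1
    have h1 : HasDerivAt (fun m : ℂ ↦ m • z) z m := by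
      simpa using (hasDerivAt_id m).smul_const z
    have h2 := ((hf.differentiableAt (hΩ.mem_nhds hm.2)).hasFDerivAt.comp_hasDerivAt m h1).mul
      ((hasDerivAt_pow k m).inv (pow_ne_zero k hm0))
    refine h2.congr_deriv ?_
    have h3 := he _ hm.2
    rw [map_smul, smul_eq_mul] at h3
    rw [show fderiv ℂ f (m • z) z = m⁻¹ * (k * f (m • z)) by rw [← h3]; field_simp]
    -- The derivative of `m ^ k` contains the truncated exponent `k - 1`, so `k = 0` is separate.
    rcases k with _ | k
    · simp
    · simp only [Function.comp_apply, Pi.inv_apply, Nat.add_sub_cancel]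
      field_simp
      ring

theorem clm_apply_eq_sum (A : (Fin n → ℂ) →L[ℂ] ℂ) (z : Fin n → ℂ) :
    A z = ∑ j, z j * A (Pi.single j 1) := by
  conv_lhs => rw [pi_eq_sum_univ' z]
  simp

/-- The derivative of a homogeneous function of degree `1` is homogeneous of degree `0`. -/
theorem isHomogeneousOn_zero_of_euler (hΩ : IsOpen Ω) {f : (Fin n → ℂ) → ℂ}
    (hf : ContDiffOn ℂ ω f Ω) (he : ∀ z ∈ Ω, fderiv ℂ f z z = f z) (v : Fin n → ℂ) :
    IsHomogeneousOn (fun z ↦ fderiv ℂ f z v) Ω 0 := by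
  have hd : ∀ z ∈ Ω, DifferentiableAt ℂ (fderiv ℂ f) z := fun z hz ↦
    ((hf.contDiffAt (hΩ.mem_nhds hz)).fderiv_right (m := 1) (by simp)).differentiableAt (by simp)
  refine isHomogeneousOn_of_euler hΩ
    (fun z hz ↦ ((hd z hz).clm_apply (differentiableAt_const v)).differentiableWithinAt)
    fun z hz ↦ ?_
  -- Differentiating `df_w(w) = f(w)` along `v` leaves `d²f_z(v, z) = 0`; by symmetry of `d²f` this
  -- is Euler's relation of degree 0 for `w ↦ df_w(v)`.
  have h1 : HasFDerivAt (fun w ↦ fderiv ℂ f w w)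
      ((fderiv ℂ f z).comp (ContinuousLinearMap.id ℂ _) + (fderiv ℂ (fderiv ℂ f) z).flip z) z :=
    (hd z hz).hasFDerivAt.clm_apply (hasFDerivAt_id z)
  have h2 : fderiv ℂ (fun w ↦ fderiv ℂ f w w) z = fderiv ℂ f z :=
    EventuallyEq.fderiv_eq (eventually_of_mem (hΩ.mem_nhds hz) he)
  rw [h1.fderiv] at h2
  have h3 := congrArg (fun A : (Fin n → ℂ) →L[ℂ] ℂ ↦ A v) h2
  have h4 : IsSymmSndFDerivAt ℂ f z :=
    (hf.contDiffAt (hΩ.mem_nhds hz)).isSymmSndFDerivAt (by simp)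
  have h5 : HasFDerivAt (fun w ↦ fderiv ℂ f w v) ((fderiv ℂ (fderiv ℂ f) z).flip v) z := by
    simpa using (hd z hz).hasFDerivAt.clm_apply (hasFDerivAt_const v z)
  rw [h5.fderiv]
  simp at h3
  simpa [h4 z v] using h3

variable {L : Fin n → (Fin n → ℂ) → ℂ}

/-- The homogeneous prepotential of the functions `L j`. -/
def homogeneousPrepotential (L : Fin n → (Fin n → ℂ) → ℂ) (z : Fin n → ℂ) : ℂ :=
  (-1 / 16) * ∑ j, z j * L j z

theorem contDiffOn_homogeneousPrepotential (hL : ∀ j, ContDiffOn ℂ ω (L j) Ω) :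
    ContDiffOn ℂ ω (homogeneousPrepotential L) Ω :=
  contDiffOn_const.mul (ContDiffOn.sum fun j _ ↦ (contDiff_apply ℂ ℂ j).contDiffOn.mul (hL j))

/-- The product rule gives `L k + ∑ z_j ∂_k L_j`. By symmetry and Euler's relation the sum is again
`L k`, which doubles `-1/16` to `-1/8`. -/
theorem fderiv_homogeneousPrepotential (hΩ : IsOpen Ω) (hL : ∀ j, ContDiffOn ℂ ω (L j) Ω)
    (he : ∀ j, ∀ z ∈ Ω, fderiv ℂ (L j) z z = L j z)
    (hs : ∀ z ∈ Ω, ∀ j k, fderiv ℂ (L j) z (Pi.single k 1) = fderiv ℂ (L k) z (Pi.single j 1))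
    {z : Fin n → ℂ} (hz : z ∈ Ω) (k : Fin n) :
    fderiv ℂ (homogeneousPrepotential L) z (Pi.single k 1) = (-1 / 8) * L k z := by
  have hd : ∀ j, HasFDerivAt (L j) (fderiv ℂ (L j) z) z := fun j ↦
    (((hL j).contDiffAt (hΩ.mem_nhds hz)).differentiableAt (by simp)).hasFDerivAt
  have h1 := (HasFDerivAt.fun_sum (u := Finset.univ) fun j _ ↦
    (hasFDerivAt_apply (𝕜 := ℂ) j z).mul (hd j)).const_mul (-1 / 16 : ℂ)
  have h2 : fderiv ℂ (homogeneousPrepotential L) z = _ := h1.fderiv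
  have h3 := clm_apply_eq_sum (fderiv ℂ (L k) z) z
  rw [he k z hz] at h3
  rw [h2]
  simp only [smul_apply, sum_apply, add_apply, ContinuousLinearMap.proj_apply,
    Pi.single_apply, smul_eq_mul, Finset.sum_add_distrib, hs z hz _ k, ← h3]
  simp
  ring

theorem isHomogeneousOn_homogeneousPrepotential (hΩ : IsOpen Ω) (hL : ∀ j, ContDiffOn ℂ ω (L j) Ω)
    (he : ∀ j, ∀ z ∈ Ω, fderiv ℂ (L j) z z = L j z)
    (hs : ∀ z ∈ Ω, ∀ j k, fderiv ℂ (L j) z (Pi.single k 1) = fderiv ℂ (L k) z (Pi.single j 1)) :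
    IsHomogeneousOn (homogeneousPrepotential L) Ω 2 := by
  refine isHomogeneousOn_of_euler hΩ
    ((contDiffOn_homogeneousPrepotential hL).differentiableOn (by simp)) fun z hz ↦ ?_
  rw [clm_apply_eq_sum]
  simp only [fderiv_homogeneousPrepotential hΩ hL he hs hz, homogeneousPrepotential,
    Finset.mul_sum]
  exact Finset.sum_congr rfl fun j _ ↦ by push_cast; ring

theorem IsHomogeneousOn.congr {f g : (Fin n → ℂ) → ℂ} {k : ℕ} (hf : IsHomogeneousOn f Ω k)
    (h : EqOn g f Ω) : IsHomogeneousOn g Ω k := fun z hz l hl ↦ by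
  rw [h hz, h hl.target_mem.2, hf z hz l hl]

theorem clm_ext_single {A B : (Fin n → ℂ) →L[ℂ] ℂ}
    (h : ∀ j, A (Pi.single j 1) = B (Pi.single j 1)) : A = B := by
  ext z
  rw [clm_apply_eq_sum A, clm_apply_eq_sum B]
  simp only [h]

/-- Two functions on a connected open set with the same partial derivatives differ by a constant. -/
theorem exists_add_const_eqOn (hΩ : IsOpen Ω) (hΩ' : IsPreconnected Ω) {f g : (Fin n → ℂ) → ℂ}
    (hf : DifferentiableOn ℂ f Ω) (hg : DifferentiableOn ℂ g Ω)
    (h : ∀ z ∈ Ω, ∀ j, fderiv ℂ f z (Pi.single j 1) = fderiv ℂ g z (Pi.single j 1)) :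
    ∃ b : ℂ, EqOn (fun z ↦ f z + b) g Ω := by
  obtain ⟨b, hb⟩ := hΩ.exists_is_const_of_fderiv_eq_zero hΩ' (hg.sub hf) fun z hz ↦ by
    rw [fderiv_sub (hg.differentiableAt (hΩ.mem_nhds hz)) (hf.differentiableAt (hΩ.mem_nhds hz)),
      clm_ext_single (h z hz), sub_self]
    rfl
  exact ⟨b, fun z hz ↦ by rw [← hb z hz]; simp⟩

end Calculus

/-! ### Holomorphic functions with affine real part. -/

section HolomorphicFunctions

variable {E : Type*} [NormedAddCommGroup E] [NormedSpace ℂ E]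
variable {M : Type*} [TopologicalSpace M] [ChartedSpace E M]

theorem mvfderiv_re_toReal {f : M → ℂ} {x : M} (hf : MDifferentiableAt 𝓘(ℂ, E) 𝓘(ℂ, ℂ) f x)
    (v : TangentSpace 𝓘(ℂ, E) x) :
    mvfderiv 𝓘(ℝ, E) (fun y ↦ (f y).re) x (toReal x v) = (mvfderiv 𝓘(ℂ, E) f x v).re :=
  (mvfderiv_clm_comp Complex.reCLM (mdifferentiableAt_real hf) (toReal x v)).trans
    (congrArg Complex.re (mfderiv_real hf v))

theorem mvfderiv_re_J {f : M → ℂ} {x : M} (hf : MDifferentiableAt 𝓘(ℂ, E) 𝓘(ℂ, ℂ) f x)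
    (v : TangentSpace 𝓘(ℂ, E) x) :
    mvfderiv 𝓘(ℝ, E) (fun y ↦ (f y).re) x (J x (toReal x v)) = -(mvfderiv 𝓘(ℂ, E) f x v).im := by
  have h : J x (toReal x v) = toReal x (Complex.I • v) := rfl
  rw [h, mvfderiv_re_toReal hf, map_smul]
  simp

theorem mvfderiv_eq_zero_of_re {f : M → ℂ} {x : M}
    (h : ∀ v : TangentSpace 𝓘(ℂ, E) x, (mvfderiv 𝓘(ℂ, E) f x v).re = 0) :
    mvfderiv 𝓘(ℂ, E) f x = 0 := by
  ext v
  refine Complex.ext (h v) ?_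
  have := h (Complex.I • v)
  rw [map_smul] at this
  simpa using this

/-- No differentiability is assumed: where it fails both derivatives are `0` by convention. The
equality thus holds on all of `N`, also off the coordinate domain. -/
theorem mvfderiv_fun_add_const {𝕜 F G : Type*} [NontriviallyNormedField 𝕜] [NormedAddCommGroup F]
    [NormedSpace 𝕜 F] [NormedAddCommGroup G] [NormedSpace 𝕜 G] {N : Type*} [TopologicalSpace N]
    [ChartedSpace F N] (f : N → G) (k : G) :
    mvfderiv 𝓘(𝕜, F) (fun y ↦ f y + k) = mvfderiv 𝓘(𝕜, F) f := by
  ext1 x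
  by_cases hf : MDifferentiableAt 𝓘(𝕜, F) 𝓘(𝕜, G) f x
  · rw [mvfderiv_fun_add hf mdifferentiableAt_const, mvfderiv_const, add_zero]
  · have hf' : ¬ MDifferentiableAt 𝓘(𝕜, F) 𝓘(𝕜, G) (fun y ↦ f y + k) x := fun h ↦ hf <| by
      have := h.add (mdifferentiableAt_const (c := -k))
      refine this.congr_of_eventuallyEq (Eventually.of_forall fun y ↦ ?_)
      simp
    rw [mvfderiv, mvfderiv, mfderiv_zero_of_not_mdifferentiableAt hf,
      mfderiv_zero_of_not_mdifferentiableAt hf']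
    rfl

variable [IsManifold 𝓘(ℂ, E) ω M]

theorem mdifferentiableAt_mvfderiv_apply {f : M → ℂ} {X : Π x : M, TangentSpace 𝓘(ℂ, E) x} {x : M}
    (hf : ContMDiffAt 𝓘(ℂ, E) 𝓘(ℂ, ℂ) ω f x)
    (hX : ContMDiffAt 𝓘(ℂ, E) (𝓘(ℂ, E).prod 𝓘(ℂ, E)) ω
      (fun y ↦ (TotalSpace.mk' E y (X y) : TangentBundle 𝓘(ℂ, E) M)) x) :
    MDifferentiableAt 𝓘(ℂ, E) 𝓘(ℂ, ℂ) (fun y ↦ mvfderiv 𝓘(ℂ, E) f y (X y)) x := by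
  have h1 := ContMDiffAt.mfderiv_const (m := ω) hf le_rfl
  have h2 := ContMDiffAt.clm_apply_of_inCoordinates (b₁ := id) (b₂ := f)
    (E₁ := TangentSpace 𝓘(ℂ, E)) (E₂ := TangentSpace 𝓘(ℂ, ℂ))
    (ϕ := mfderiv 𝓘(ℂ, E) 𝓘(ℂ, ℂ) f) (v := X) h1 hX hf
  exact ((contMDiff_snd_tangentBundle_modelSpace ℂ 𝓘(ℂ, ℂ)).contMDiffAt.comp x h2).mdifferentiableAt
    (by simp)

/-- If `Re f` is flat for the connection, then `d(X f) = c df`. -/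
theorem mvfderiv_sub_eq_zero_of_isAffineOn {S : SpecialPseudoKahler E M}
    {X : Π x : M, TangentSpace 𝓘(ℂ, E) x} {c : ℂ} {U : Set M} (hU : IsOpen U)
    (hX : ∀ x ∈ U, ContMDiffAt 𝓘(ℂ, E) (𝓘(ℂ, E).prod 𝓘(ℂ, E)) ω
      (fun y ↦ (TotalSpace.mk' E y (X y) : TangentBundle 𝓘(ℂ, E) M)) x)
    (h : ∀ x ∈ U, IsInfinitesimalHomothety S (fun y ↦ toReal y (X y)) c.re c.im x)
    {f : M → ℂ} (hf : ContMDiffOn 𝓘(ℂ, E) 𝓘(ℂ, ℂ) ω f U)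
    (ha : S.conn.IsAffineOn (fun p ↦ (f p).re) U) {x : M} (hx : x ∈ U) :
    mvfderiv 𝓘(ℂ, E) (fun p ↦ mvfderiv 𝓘(ℂ, E) f p (X p) - c * f p) x = 0 := by
  have hf' : ∀ y ∈ U, ContMDiffAt 𝓘(ℂ, E) 𝓘(ℂ, ℂ) ω f y := fun y hy ↦
    hf.contMDiffAt (hU.mem_nhds hy)
  have hfd : ∀ y ∈ U, MDifferentiableAt 𝓘(ℂ, E) 𝓘(ℂ, ℂ) f y := fun y hy ↦
    (hf' y hy).mdifferentiableAt (by simp)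
  have hG := mdifferentiableAt_mvfderiv_apply (hf' x hx) (hX x hx)
  have hc : MDifferentiableAt 𝓘(ℂ, E) 𝓘(ℂ, ℂ) (fun p ↦ c * f p) x :=
    mdifferentiableAt_const.mul (hfd x hx)
  refine mvfderiv_eq_zero_of_re fun v ↦ ?_
  -- Near `x`, `Re (X f)` is the derivative of `Re f` along the real field `X`. Since `Re f` is
  -- affine, its differential at `v` is `d(Re f)(∇_v X) = d(Re f)((a + b J) v) = Re (c df(v))`.
  have h1 : mvfderiv 𝓘(ℝ, E) (fun y ↦ (mvfderiv 𝓘(ℂ, E) f y (X y)).re) x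
      = mvfderiv 𝓘(ℝ, E)
        (fun y ↦ mvfderiv 𝓘(ℝ, E) (fun p ↦ (f p).re) y (toReal y (X y))) x :=
    EventuallyEq.mfderiv_eq (eventually_of_mem (hU.mem_nhds hx) fun y hy ↦
      (mvfderiv_re_toReal (hfd y hy) (X y)).symm)
  have h2 := ha _ x hx (h x hx).diff (toReal x v)
  rw [← h1, mvfderiv_re_toReal hG, (h x hx).conn_eq, map_add, map_smul, map_smul,
    mvfderiv_re_J (hfd x hx), mvfderiv_re_toReal (hfd x hx)] at h2
  rw [mvfderiv_fun_sub hG hc, mvfderiv_fun_mul mdifferentiableAt_const (hfd x hx), mvfderiv_const]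
  simp [h2]

end HolomorphicFunctions

/-! ### Calculus in special coordinates. -/

section Coordinates

variable {E : Type*} [NormedAddCommGroup E] [NormedSpace ℂ E]
variable {M : Type*} [TopologicalSpace M] [ChartedSpace E M] [IsManifold 𝓘(ℂ, E) ω M]

namespace SpecialCoordinates

variable {S : SpecialPseudoKahler E M} {n : ℕ} (C : SpecialCoordinates S n)

theorem mdifferentiableAt_symm {z : Fin n → ℂ} (hz : z ∈ C.η.target) :
    MDifferentiableAt 𝓘(ℂ, Fin n → ℂ) 𝓘(ℂ, E) C.η.symm z :=
  (C.holo_symm.contMDiffAt (C.η.open_target.mem_nhds hz)).mdifferentiableAt (by simp)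

theorem mdifferentiableAt_η {p : M} (hp : p ∈ C.η.source) :
    MDifferentiableAt 𝓘(ℂ, E) 𝓘(ℂ, Fin n → ℂ) C.η p :=
  (C.holo.contMDiffAt (C.η.open_source.mem_nhds hp)).mdifferentiableAt (by simp)

theorem contMDiffOn_η_apply (j : Fin n) :
    ContMDiffOn 𝓘(ℂ, E) 𝓘(ℂ, ℂ) ω (fun p ↦ C.η p j) C.η.source :=
  contMDiffOn_pi_space.1 C.holo j

theorem mdifferentiableAt_η_apply (j : Fin n) {p : M} (hp : p ∈ C.η.source) :
    MDifferentiableAt 𝓘(ℂ, E) 𝓘(ℂ, ℂ) (fun p ↦ C.η p j) p :=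
  ((C.contMDiffOn_η_apply j).contMDiffAt (C.η.open_source.mem_nhds hp)).mdifferentiableAt (by simp)

theorem mdifferentiableAt_lam (j : Fin n) {p : M} (hp : p ∈ C.η.source) :
    MDifferentiableAt 𝓘(ℂ, E) 𝓘(ℂ, ℂ) (C.lam j) p :=
  ((C.holo_lam j).contMDiffAt (C.η.open_source.mem_nhds hp)).mdifferentiableAt (by simp)

theorem exists_hasFDerivAt_comp_symm {h : M → ℂ} {z : Fin n → ℂ} (hz : z ∈ C.η.target)
    (hh : MDifferentiableAt 𝓘(ℂ, E) 𝓘(ℂ, ℂ) h (C.η.symm z)) :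
    ∃ A : (Fin n → ℂ) →L[ℂ] ℂ, HasFDerivAt (fun w ↦ h (C.η.symm w)) A z ∧ ∀ w, A w =
      mvfderiv 𝓘(ℂ, E) h (C.η.symm z) (mfderiv 𝓘(ℂ, Fin n → ℂ) 𝓘(ℂ, E) C.η.symm z w) :=
  ⟨_, (hh.hasMFDerivAt.comp z (C.mdifferentiableAt_symm hz).hasMFDerivAt).hasFDerivAt, fun _ ↦ rfl⟩

theorem fderiv_comp_symm {h : M → ℂ} {z : Fin n → ℂ} (hz : z ∈ C.η.target)
    (hh : MDifferentiableAt 𝓘(ℂ, E) 𝓘(ℂ, ℂ) h (C.η.symm z)) (w : Fin n → ℂ) :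
    fderiv ℂ (fun w ↦ h (C.η.symm w)) z w =
      mvfderiv 𝓘(ℂ, E) h (C.η.symm z) (mfderiv 𝓘(ℂ, Fin n → ℂ) 𝓘(ℂ, E) C.η.symm z w) := by
  obtain ⟨A, hA, hAw⟩ := C.exists_hasFDerivAt_comp_symm hz hh
  rw [hA.fderiv]
  exact hAw w

theorem mvfderiv_η_apply {p : M} (hp : p ∈ C.η.source) (j : Fin n) (v : TangentSpace 𝓘(ℂ, E) p) :
    mvfderiv 𝓘(ℂ, E) (fun q ↦ C.η q j) p v
      = (mfderiv 𝓘(ℂ, E) 𝓘(ℂ, Fin n → ℂ) C.η p v : Fin n → ℂ) j :=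
  congrArg (fun L : E →L[ℂ] ℂ ↦ L v)
    (((ContinuousLinearMap.proj (R := ℂ) (φ := fun _ : Fin n ↦ ℂ) j).hasFDerivAt
      (x := C.η p)).hasMFDerivAt.comp p (C.mdifferentiableAt_η hp).hasMFDerivAt).mfderiv

theorem mfderiv_symm_mfderiv {p : M} (hp : p ∈ C.η.source) (v : TangentSpace 𝓘(ℂ, E) p) :
    mfderiv 𝓘(ℂ, Fin n → ℂ) 𝓘(ℂ, E) C.η.symm (C.η p) (mfderiv 𝓘(ℂ, E) 𝓘(ℂ, Fin n → ℂ) C.η p v)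
      = v := by
  have h1 : HasMFDerivAt 𝓘(ℂ, E) 𝓘(ℂ, E) (C.η.symm ∘ C.η) p _ :=
    (C.mdifferentiableAt_symm (C.η.map_source hp)).hasMFDerivAt.comp p
      (C.mdifferentiableAt_η hp).hasMFDerivAt
  have h2 : HasMFDerivAt 𝓘(ℂ, E) 𝓘(ℂ, E) (C.η.symm ∘ C.η) p
      (ContinuousLinearMap.id ℂ (TangentSpace 𝓘(ℂ, E) p)) :=
    (hasMFDerivAt_id p).congr_of_eventuallyEq (C.η.eventually_left_inverse hp)
  exact congrArg (fun L : E →L[ℂ] E ↦ L v) (hasMFDerivAt_unique h1 h2)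

theorem mfderiv_mfderiv_symm {z : Fin n → ℂ} (hz : z ∈ C.η.target) (w : Fin n → ℂ) :
    (mfderiv 𝓘(ℂ, E) 𝓘(ℂ, Fin n → ℂ) C.η (C.η.symm z)
      (mfderiv 𝓘(ℂ, Fin n → ℂ) 𝓘(ℂ, E) C.η.symm z w) : Fin n → ℂ) = w := by
  have h1 : HasMFDerivAt 𝓘(ℂ, Fin n → ℂ) 𝓘(ℂ, Fin n → ℂ) (C.η ∘ C.η.symm) z _ :=
    (C.mdifferentiableAt_η (C.η.map_target hz)).hasMFDerivAt.comp z
      (C.mdifferentiableAt_symm hz).hasMFDerivAt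
  have h2 : HasMFDerivAt 𝓘(ℂ, Fin n → ℂ) 𝓘(ℂ, Fin n → ℂ) (C.η ∘ C.η.symm) z
      (ContinuousLinearMap.id ℂ (TangentSpace 𝓘(ℂ, Fin n → ℂ) z)) :=
    (hasMFDerivAt_id z).congr_of_eventuallyEq (C.η.eventually_right_inverse hz)
  exact congrArg (fun L : (Fin n → ℂ) →L[ℂ] (Fin n → ℂ) ↦ L w) (hasMFDerivAt_unique h1 h2)

theorem isPreconnected_target (h : IsPreconnected C.η.source) : IsPreconnected C.η.target := by
  rw [← C.η.image_source_eq_target]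
  exact h.image _ C.η.continuousOn

theorem exists_eq_const (hc : IsPreconnected C.η.source) {h : M → ℂ}
    (hd : ∀ p ∈ C.η.source, MDifferentiableAt 𝓘(ℂ, E) 𝓘(ℂ, ℂ) h p)
    (h0 : ∀ p ∈ C.η.source, mvfderiv 𝓘(ℂ, E) h p = 0) : ∃ k, ∀ p ∈ C.η.source, h p = k := by
  obtain ⟨k, hk⟩ := C.η.open_target.exists_is_const_of_fderiv_eq_zero (𝕜 := ℂ)
    (f := fun w ↦ h (C.η.symm w)) (C.isPreconnected_target hc)
    (fun z hz ↦ by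
      obtain ⟨A, hA, -⟩ := C.exists_hasFDerivAt_comp_symm hz (hd _ (C.η.map_target hz))
      exact hA.differentiableAt.differentiableWithinAt)
    fun z hz ↦ ContinuousLinearMap.ext fun w ↦ by
      rw [C.fderiv_comp_symm hz (hd _ (C.η.map_target hz)), h0 _ (C.η.map_target hz)]
      rfl
  refine ⟨k, fun p hp ↦ ?_⟩
  rw [← hk _ (C.η.map_source hp), C.η.left_inv hp]

end SpecialCoordinates

end Coordinates

/-! ### Normalizing special coordinates by constants. -/

section Translation

variable {E : Type*} [NormedAddCommGroup E] [NormedSpace ℂ E]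
variable {M : Type*} [TopologicalSpace M] [ChartedSpace E M]

theorem mvfderiv_re_add_const (f : M → ℂ) (k : ℂ) :
    mvfderiv 𝓘(ℝ, E) (fun p ↦ (f p + k).re) = mvfderiv 𝓘(ℝ, E) (fun p ↦ (f p).re) :=
  mvfderiv_fun_add_const (fun p ↦ (f p).re) k.re

theorem mvfderiv_neg_re_add_const (f : M → ℂ) (k : ℂ) :
    mvfderiv 𝓘(ℝ, E) (fun p ↦ -(f p + k).re) = mvfderiv 𝓘(ℝ, E) (fun p ↦ -(f p).re) := by
  have := mvfderiv_fun_add_const (𝕜 := ℝ) (F := E) (fun p ↦ -(f p).re) (-k.re)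
  simpa [← neg_add_rev, add_comm] using this

variable [IsManifold 𝓘(ℂ, E) ω M]

theorem Connection.IsAffineOn.congr {D : Connection E M} {f g : M → ℝ} {U : Set M}
    (hf : D.IsAffineOn f U) (h : mvfderiv 𝓘(ℝ, E) g = mvfderiv 𝓘(ℝ, E) f) : D.IsAffineOn g U := by
  intro Y x hx hY v
  rw [h]
  exact hf Y x hx hY v

theorem Connection.IsAffineOn.neg {D : Connection E M} {f : M → ℝ} {U : Set M}
    (hf : D.IsAffineOn f U) : D.IsAffineOn (fun p ↦ -f p) U := by
  intro Y x hx hY v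
  simp only [mvfderiv_fun_neg, neg_apply]
  rw [hf Y x hx hY v]

variable {S : SpecialPseudoKahler E M} {n : ℕ} (C : SpecialCoordinates S n)

namespace SpecialCoordinates

/-- Special coordinates and conjugate functions, after adding constants. -/
def translate (a a' : Fin n → ℂ) : SpecialCoordinates S n where
  η := C.η.transHomeomorph (Homeomorph.addRight a)
  holo := C.holo.add contMDiffOn_const
  holo_symm := C.holo_symm.comp (s := (fun z ↦ z + -a) ⁻¹' C.η.target)
    (contMDiff_id.add contMDiff_const).contMDiffOn fun _ h ↦ h
  lam j p := C.lam j p + a' j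
  holo_lam j := (C.holo_lam j).add contMDiffOn_const
  affine_x j := (C.affine_x j).congr (mvfderiv_re_add_const (fun p ↦ C.η p j) (a j))
  affine_y j := (C.affine_y j).congr (mvfderiv_neg_re_add_const (C.lam j) (a' j))
  darboux p hp v w := by
    refine (C.darboux p hp v w).trans (Finset.sum_congr rfl fun j _ ↦ ?_)
    have h1 := mvfderiv_re_add_const (E := E) (fun p ↦ C.η p j) (a j)
    have h2 := mvfderiv_neg_re_add_const (E := E) (C.lam j) (a' j)
    rw [h2]
    change _ = mvfderiv 𝓘(ℝ, E) (fun q ↦ (C.η q j + a j).re) p v * _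
      - mvfderiv 𝓘(ℝ, E) (fun q ↦ (C.η q j + a j).re) p w * _
    rw [h1]

/-- The coordinates and the conjugate functions are multiplied by `c` under the derivative along
the holomorphic vector field `X`. -/
structure IsHomogeneousFor (X : Π x : M, TangentSpace 𝓘(ℂ, E) x) (c : ℂ) : Prop where
  η_apply : ∀ p ∈ C.η.source, ∀ j, mvfderiv 𝓘(ℂ, E) (fun q ↦ C.η q j) p (X p) = c * C.η p j
  lam : ∀ p ∈ C.η.source, ∀ j, mvfderiv 𝓘(ℂ, E) (C.lam j) p (X p) = c * C.lam j p

theorem exists_mvfderiv_eq_mul_add {X : Π x : M, TangentSpace 𝓘(ℂ, E) x} {c : ℂ}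
    (hX : ContMDiff 𝓘(ℂ, E) (𝓘(ℂ, E).prod 𝓘(ℂ, E)) ω
      (fun y ↦ (TotalSpace.mk' E y (X y) : TangentBundle 𝓘(ℂ, E) M)))
    (h : ∀ x, IsInfinitesimalHomothety S (fun y ↦ toReal y (X y)) c.re c.im x)
    (hc : IsPreconnected C.η.source) {f : M → ℂ}
    (hf : ContMDiffOn 𝓘(ℂ, E) 𝓘(ℂ, ℂ) ω f C.η.source)
    (ha : S.conn.IsAffineOn (fun p ↦ (f p).re) C.η.source) :
    ∃ k, ∀ p ∈ C.η.source, mvfderiv 𝓘(ℂ, E) f p (X p) = c * f p + k := by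
  obtain ⟨k, hk⟩ := C.exists_eq_const hc
    (h := fun p ↦ mvfderiv 𝓘(ℂ, E) f p (X p) - c * f p)
    (fun p hp ↦ by
      have hfp := hf.contMDiffAt (C.η.open_source.mem_nhds hp)
      exact (mdifferentiableAt_mvfderiv_apply hfp (hX p)).sub
        (mdifferentiableAt_const.mul (hfp.mdifferentiableAt (by simp))))
    (fun p hp ↦ mvfderiv_sub_eq_zero_of_isAffineOn C.η.open_source (fun x _ ↦ hX x)
      (fun x _ ↦ h x) hf ha hp)
  exact ⟨k, fun p hp ↦ by rw [← hk p hp]; ring⟩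

/-- If `c ≠ 0`, special coordinates become homogeneous after adding constants. -/
theorem exists_translate_isHomogeneousFor {X : Π x : M, TangentSpace 𝓘(ℂ, E) x} {c : ℂ}
    (hX : ContMDiff 𝓘(ℂ, E) (𝓘(ℂ, E).prod 𝓘(ℂ, E)) ω
      (fun y ↦ (TotalSpace.mk' E y (X y) : TangentBundle 𝓘(ℂ, E) M)))
    (h : ∀ x, IsInfinitesimalHomothety S (fun y ↦ toReal y (X y)) c.re c.im x)
    (hc : IsPreconnected C.η.source) (hc0 : c ≠ 0) :
    ∃ a a' : Fin n → ℂ, (C.translate a a').IsHomogeneousFor X c := by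
  choose k hk using fun j ↦
    C.exists_mvfderiv_eq_mul_add hX h hc (C.contMDiffOn_η_apply j) (C.affine_x j)
  choose k' hk' using fun j ↦
    C.exists_mvfderiv_eq_mul_add hX h hc (C.holo_lam j)
      (by simpa only [neg_neg] using (C.affine_y j).neg)
  -- From `X f = c f + k` one gets `X (f + k / c) = c (f + k / c)`.
  refine ⟨fun j ↦ k j / c, fun j ↦ k' j / c, fun p hp j ↦ ?_, fun p hp j ↦ ?_⟩
  · have h1 := mvfderiv_fun_add_const (𝕜 := ℂ) (F := E) (fun q ↦ C.η q j) (k j / c)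
    change mvfderiv 𝓘(ℂ, E) (fun q ↦ C.η q j + k j / c) p (X p) = c * (C.η p j + k j / c)
    rw [h1, hk j p hp]
    field_simp
  · have h1 := mvfderiv_fun_add_const (𝕜 := ℂ) (F := E) (C.lam j) (k' j / c)
    change mvfderiv 𝓘(ℂ, E) (fun q ↦ C.lam j q + k' j / c) p (X p) = c * (C.lam j p + k' j / c)
    rw [h1, hk' j p hp]
    field_simp

end SpecialCoordinates

end Translation

/-! ### Euler's relation for the conjugate functions and symmetry of `τ`. -/

section Homogeneity

variable {E : Type*} [NormedAddCommGroup E] [NormedSpace ℂ E]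
variable {M : Type*} [TopologicalSpace M] [ChartedSpace E M]

/-- The map `v ↦ (v - i J v) / 2` is complex linear. -/
def toType10Linear (x : M) : TangentSpace 𝓘(ℂ, E) x →ₗ[ℂ] TangentCx (E := E) x where
  toFun := toType10 x
  map_add' v w := by
    have : toReal x (v + w) = toReal x v + toReal x w := rfl
    ext
    · simp [toType10, this]
    · simp [toType10, this]; module
  map_smul' c v := by
    have : toReal x (c • v) = c.re • toReal x v + c.im • J x (toReal x v) := by
      have key : ∀ u : E, c • u = c.re • u + c.im • Complex.I • u := fun u ↦ by
        rw [← Complex.coe_smul, ← Complex.coe_smul, smul_smul, ← add_smul, Complex.re_add_im]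
      exact key v
    ext <;> simp [toType10, this, J_J] <;> module

variable [IsManifold 𝓘(ℂ, E) ω M]
variable {S : SpecialPseudoKahler E M} {n : ℕ} {C : SpecialCoordinates S n}
variable {X : Π x : M, TangentSpace 𝓘(ℂ, E) x} {c : ℂ}

namespace SpecialCoordinates.IsHomogeneousFor

theorem mfderiv_η (h : C.IsHomogeneousFor X c) {p : M} (hp : p ∈ C.η.source) :
    (mfderiv 𝓘(ℂ, E) 𝓘(ℂ, Fin n → ℂ) C.η p (X p) : Fin n → ℂ) = c • C.η p := by
  funext j
  rw [← C.mvfderiv_η_apply hp, h.η_apply p hp]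
  rfl

theorem mfderiv_symm (h : C.IsHomogeneousFor X c) {p : M} (hp : p ∈ C.η.source) :
    mfderiv 𝓘(ℂ, Fin n → ℂ) 𝓘(ℂ, E) C.η.symm (C.η p) (c • C.η p) = X p := by
  have h1 := C.mfderiv_symm_mfderiv hp (X p)
  rwa [h.mfderiv_η hp] at h1

theorem toType10_eq_sum (h : C.IsHomogeneousFor X c) {p : M} (hp : p ∈ C.η.source) :
    toType10 p (X p) = ∑ α, (c * C.η p α) • C.coordVec α p := by
  let A : (Fin n → ℂ) →ₗ[ℂ] TangentCx (E := E) p := (toType10Linear p).comp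
    (mfderiv 𝓘(ℂ, Fin n → ℂ) 𝓘(ℂ, E) C.η.symm (C.η p) : (Fin n → ℂ) →L[ℂ] E).toLinearMap
  have h1 : toType10 p (X p) = A (c • C.η p) := congrArg (toType10 p) (h.mfderiv_symm hp).symm
  have h2 : A (c • C.η p) = ∑ α, (c * C.η p α) • A (Pi.single α 1) := by
    conv_lhs => rw [pi_eq_sum_univ' (c • C.η p), map_sum]
    simp only [map_smul, Pi.smul_apply, smul_eq_mul]
  exact h1.trans h2

theorem euler_lam (h : C.IsHomogeneousFor X c) (hc : c ≠ 0) (j : Fin n) {z : Fin n → ℂ}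
    (hz : z ∈ C.η.target) :
    fderiv ℂ (fun w ↦ C.lam j (C.η.symm w)) z z = C.lam j (C.η.symm z) := by
  have hp := C.η.map_target hz
  have h1 := h.mfderiv_symm hp
  rw [C.η.right_inv hz] at h1
  apply mul_left_cancel₀ hc
  rw [← smul_eq_mul, ← map_smul, C.fderiv_comp_symm hz (C.mdifferentiableAt_lam j hp), ← h.lam _ hp j]
  exact congrArg (fun v ↦ mvfderiv 𝓘(ℂ, E) (C.lam j) (C.η.symm z) v) h1

end SpecialCoordinates.IsHomogeneousFor

theorem SpecialCoordinates.contDiffOn_lam_symm (C : SpecialCoordinates S n) (j : Fin n) :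
    ContDiffOn ℂ ω (fun w ↦ C.lam j (C.η.symm w)) C.η.target :=
  contMDiffOn_iff_contDiffOn.1 ((C.holo_lam j).comp C.holo_symm fun _ hz ↦ C.η.map_target hz)

/-- The real part of `∑ dη^j ∧ dλ_j` on `(v, w)` is `Φ(J v, J w) - Φ(v, w)`, which vanishes because
`g` is hermitian. The form is complex bilinear, so replacing `v` by `i v` disposes of the imaginary
part. -/
theorem SpecialCoordinates.symplectic_complex (C : SpecialCoordinates S n) {p : M}
    (hp : p ∈ C.η.source) (v w : TangentSpace 𝓘(ℂ, E) p) :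
    ∑ j, (mvfderiv 𝓘(ℂ, E) (fun q ↦ C.η q j) p v * mvfderiv 𝓘(ℂ, E) (C.lam j) p w
      - mvfderiv 𝓘(ℂ, E) (fun q ↦ C.η q j) p w * mvfderiv 𝓘(ℂ, E) (C.lam j) p v) = 0 := by
  have hx := fun j ↦ C.mdifferentiableAt_η_apply j hp
  have hy := fun j ↦ C.mdifferentiableAt_lam j hp
  have re : ∀ v w : TangentSpace 𝓘(ℂ, E) p,
      (∑ j, (mvfderiv 𝓘(ℂ, E) (fun q ↦ C.η q j) p v * mvfderiv 𝓘(ℂ, E) (C.lam j) p w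
      - mvfderiv 𝓘(ℂ, E) (fun q ↦ C.η q j) p w * mvfderiv 𝓘(ℂ, E) (C.lam j) p v)).re = 0 := by
    intro v w
    have h1 := C.darboux p hp (toReal p v) (toReal p w)
    have h2 := C.darboux p hp (J p (toReal p v)) (J p (toReal p w))
    have h3 : S.Φ p (J p (toReal p v)) (J p (toReal p w)) = S.Φ p (toReal p v) (toReal p w) :=
      S.hermitian _ _ _
    rw [h3, h1, ← sub_eq_zero, ← Finset.sum_sub_distrib] at h2
    rw [Complex.re_sum, ← neg_eq_zero, ← Finset.sum_neg_distrib, ← h2]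
    refine Finset.sum_congr rfl fun j _ ↦ ?_
    simp only [mvfderiv_fun_neg, neg_apply, mvfderiv_re_toReal (hx j),
      mvfderiv_re_toReal (hy j), mvfderiv_re_J (hx j), mvfderiv_re_J (hy j), Complex.sub_re,
      Complex.mul_re]
    ring
  refine Complex.ext (re v w) ?_
  have h := re (Complex.I • v) w
  simp only [map_smul, smul_eq_mul] at h
  rw [Complex.zero_im, ← neg_eq_zero, ← Complex.I_mul_re, Finset.mul_sum, ← h]
  congr 1
  exact Finset.sum_congr rfl fun j _ ↦ by ring

/-- This is `∑ dη^i ∧ dλ_i = 0` evaluated on `∂/∂η^j` and `∂/∂η^k`. -/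
theorem SpecialCoordinates.fderiv_lam_symm (C : SpecialCoordinates S n) {z : Fin n → ℂ}
    (hz : z ∈ C.η.target) (j k : Fin n) :
    fderiv ℂ (fun w ↦ C.lam j (C.η.symm w)) z (Pi.single k 1)
      = fderiv ℂ (fun w ↦ C.lam k (C.η.symm w)) z (Pi.single j 1) := by
  have hp := C.η.map_target hz
  have h := C.symplectic_complex hp
    (mfderiv 𝓘(ℂ, Fin n → ℂ) 𝓘(ℂ, E) C.η.symm z (Pi.single j (1 : ℂ) : Fin n → ℂ))
    (mfderiv 𝓘(ℂ, Fin n → ℂ) 𝓘(ℂ, E) C.η.symm z (Pi.single k (1 : ℂ) : Fin n → ℂ))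
  simp only [C.mvfderiv_η_apply hp, C.mfderiv_mfderiv_symm hz,
    ← C.fderiv_comp_symm hz (C.mdifferentiableAt_lam _ hp)] at h
  simpa [Pi.single_apply, sub_eq_zero] using h

end Homogeneity

/-! ### Integrating the eigenvalue equation along orbits. -/

section Orbits

variable {E : Type*} [NormedAddCommGroup E] [NormedSpace ℂ E]
variable {M : Type*} [TopologicalSpace M] [ChartedSpace E M]
variable [MulAction ℂˣ M] [ContMDiffSMul 𝓘(ℂ, ℂ) 𝓘(ℂ, E) ω ℂˣ M]

theorem hasDerivAt_comp_orbit {f : M → ℂ} {p : M} {l : ℂ}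
    (hf : MDifferentiableAt 𝓘(ℂ, E) 𝓘(ℂ, ℂ) f (expUnit l • p)) :
    HasDerivAt (fun m ↦ f (expUnit m • p))
      (mvfderiv 𝓘(ℂ, E) f (expUnit l • p) (fundamentalVelocity E (expUnit l • p))) l := by
  have h0 : MDifferentiableAt 𝓘(ℂ, E) 𝓘(ℂ, ℂ) f (expUnit 0 • expUnit l • p) := by
    rwa [expUnit_zero, one_smul]
  obtain ⟨A, hA, hA1⟩ : ∃ A : ℂ →L[ℂ] ℂ, HasFDerivAt (fun m ↦ f (expUnit m • expUnit l • p)) A 0 ∧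
      A 1 = mvfderiv 𝓘(ℂ, E) f (expUnit 0 • expUnit l • p)
        (fundamentalVelocity E (expUnit l • p)) :=
    ⟨_, (HasMFDerivAt.comp (0 : ℂ) h0.hasMFDerivAt
      (mdifferentiable_orbit (expUnit l • p) 0).hasMFDerivAt).hasFDerivAt, rfl⟩
  have key : ∀ q, q = expUnit l • p →
      (mvfderiv 𝓘(ℂ, E) f q : E →L[ℂ] ℂ) (fundamentalVelocity E (expUnit l • p))
        = mvfderiv 𝓘(ℂ, E) f (expUnit l • p) (fundamentalVelocity E (expUnit l • p)) := by
    rintro q rfl; rfl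
  have h2 : HasDerivAt (fun m ↦ f (expUnit m • expUnit l • p))
      (mvfderiv 𝓘(ℂ, E) f (expUnit l • p) (fundamentalVelocity E (expUnit l • p))) (l - l) := by
    rw [sub_self, ← key (expUnit 0 • expUnit l • p) (by rw [expUnit_zero, one_smul])]
    exact hA1 ▸ hA.hasDerivAt
  -- The group law `exp m • p = exp (m - l) • (exp l • p)` moves the derivative at `l` to the one at
  -- `0`.
  refine (h2.comp_sub_const l l).congr_of_eventuallyEq (Eventually.of_forall fun m ↦ ?_)
  simp only [smul_smul, ← expUnit_add, sub_add_cancel]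

theorem apply_expUnit_smul_of_mvfderiv {f : M → ℂ} {U : Set M} (hU : IsOpen U) {c : ℂ}
    (hf : ∀ p ∈ U, MDifferentiableAt 𝓘(ℂ, E) 𝓘(ℂ, ℂ) f p)
    (h : ∀ p ∈ U, mvfderiv 𝓘(ℂ, E) f p (fundamentalVelocity E p) = c * f p) {p : M} {l : ℂ}
    (hl : JoinedIn {l' : ℂ | expUnit l' • p ∈ U} 0 l) :
    f (expUnit l • p) = Complex.exp (c * l) * f p := by
  have hW : IsOpen {l' : ℂ | expUnit l' • p ∈ U} := hU.preimage (contMDiff_orbit (E := E) p).continuous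
  -- The quantity `f(exp m • p) exp(-c m)` is constant along the orbit inside `U`.
  have key := eq_of_joinedIn_of_hasDerivAt_zero
    (φ := fun m ↦ f (expUnit m • p) * Complex.exp (-(c * m))) hW (fun m hm ↦ ?_) hl
  · simp only [expUnit_zero, one_smul, mul_zero, neg_zero, Complex.exp_zero, mul_one] at key
    rw [← key, mul_comm, mul_assoc, ← Complex.exp_add, neg_add_cancel, Complex.exp_zero, mul_one]
  · have h1 := hasDerivAt_comp_orbit (hf _ hm)
    rw [h _ hm] at h1
    have h2 : HasDerivAt (fun m : ℂ ↦ -(c * m)) (-c) m := by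
      simpa using ((hasDerivAt_id m).const_mul c).fun_neg
    refine (h1.mul h2.cexp).congr_deriv ?_
    ring

end Orbits

/-! ### Existence of the homogeneous prepotential and its uniqueness up to a constant. -/

section Prepotential

variable {E : Type*} [NormedAddCommGroup E] [NormedSpace ℂ E]
variable {M : Type*} [TopologicalSpace M] [ChartedSpace E M] [IsManifold 𝓘(ℂ, E) ω M]
variable {S : SpecialPseudoKahler E M} {n : ℕ} {C : SpecialCoordinates S n}

namespace SpecialCoordinates

/-- Homogeneous conjugate functions have a prepotential that is homogeneous of degree `2`. -/
theorem exists_isPrepotential_isHomogeneousOn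
    (he : ∀ j, ∀ z ∈ C.η.target,
      fderiv ℂ (fun w ↦ C.lam j (C.η.symm w)) z z = C.lam j (C.η.symm z)) :
    ∃ F, C.IsPrepotential F ∧ IsHomogeneousOn F C.η.target 2 := by
  refine ⟨homogeneousPrepotential fun j w ↦ C.lam j (C.η.symm w),
    ⟨contDiffOn_homogeneousPrepotential C.contDiffOn_lam_symm, fun z hz j ↦ ?_⟩,
    isHomogeneousOn_homogeneousPrepotential C.η.open_target C.contDiffOn_lam_symm he
      fun z hz ↦ C.fderiv_lam_symm hz⟩
  rw [fderiv_homogeneousPrepotential C.η.open_target C.contDiffOn_lam_symm he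
    (fun z hz ↦ C.fderiv_lam_symm hz) hz]
  ring

theorem IsPrepotential.exists_add_const_isHomogeneousOn {F G : (Fin n → ℂ) → ℂ}
    (hF : C.IsPrepotential F) (hG : C.IsPrepotential G) (hc : IsPreconnected C.η.source) {k : ℕ}
    (hk : IsHomogeneousOn G C.η.target k) :
    ∃ b : ℂ, IsHomogeneousOn (fun z ↦ F z + b) C.η.target k := by
  obtain ⟨b, hb⟩ := exists_add_const_eqOn C.η.open_target (C.isPreconnected_target hc)
    (hF.1.differentiableOn (by simp)) (hG.1.differentiableOn (by simp)) fun z hz j ↦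
      mul_left_cancel₀ (by norm_num : (-8 : ℂ) ≠ 0) ((hF.2 z hz j).symm.trans (hG.2 z hz j))
  exact ⟨b, hk.congr hb⟩

end SpecialCoordinates

end Prepotential

end

end SpecialKahler

/-! ### The main theorem. -/

theorem mainTheorem3
    {E : Type*} [NormedAddCommGroup E] [NormedSpace ℂ E] [FiniteDimensional ℂ E]
    {M : Type*} [TopologicalSpace M] [T2Space M] [ChartedSpace E M] [IsManifold 𝓘(ℂ, E) ω M]
    -- a rigid special pseudo-Kähler structure and a free holomorphic action
    (S : SpecialPseudoKahler E M)
    [MulAction ℂˣ M] [ContMDiffSMul 𝓘(ℂ, ℂ) 𝓘(ℂ, E) ω ℂˣ M]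
    (hfree : ∀ (b : ℂˣ) (x : M), b • x = x → b = 1)
    -- the fundamental vector field `H` is non null and `∇_Y H = c Y`
    (hnull : ∀ x : M,
      S.gCx x (fundamentalField E x) (fundamentalField E x).conj ≠ 0)
    (c : ℂ)
    (hH : ∀ (x : M) (Y : TangentCx (E := E) x), IsType10 x Y →
      S.conn.cx (fundamentalField E) x Y = c • Y) :
    -- `H` is a holomorphic vector field of type `(1, 0)`
    (∀ x : M, IsType10 x (fundamentalField E x)) ∧
    ContMDiff 𝓘(ℂ, E) (𝓘(ℂ, E).prod 𝓘(ℂ, E)) ω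
      (fun x : M ↦ (TotalSpace.mk' E x (fundamentalVelocity E x) : TangentBundle 𝓘(ℂ, E) M)) ∧
    -- `D_Y H = c Y` for the Levi-Civita connection
    (∀ D : Connection E M, S.IsLeviCivita D →
      ∀ (x : M) (Y : TangentCx (E := E) x), IsType10 x Y →
        D.cx (fundamentalField E) x Y = c • Y) ∧
    -- `L_H g = c g`
    (∀ (Y Z : Π x : M, TangentCx (E := E) x) (x : M),
      VDiffAt (fun y ↦ (Y y).re) x → VDiffAt (fun y ↦ (Y y).im) x →
      VDiffAt (fun y ↦ (Z y).re) x → VDiffAt (fun y ↦ (Z y).im) x →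
        S.lieDeriv (fundamentalField E) Y Z x = c * S.gCx x (Y x) (Z x)) ∧
    -- special coordinates, after adding constants
    (c ≠ 0 → ∀ (n : ℕ) (C : SpecialCoordinates S n), IsPreconnected C.η.source →
      ∃ (a a' : Fin n → ℂ) (C' : SpecialCoordinates S n),
        C'.η.source = C.η.source ∧
        (∀ p ∈ C.η.source, C'.η p = C.η p + a) ∧
        (∀ p ∈ C.η.source, ∀ j, C'.lam j p = C.lam j p + a' j) ∧
        -- `H = c η ^ α ∂_α`, and the action multiplies the coordinates by scalars
        (∀ p ∈ C'.η.source, fundamentalField E p = ∑ α, (c * C'.η p α) • C'.coordVec α p) ∧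
        (∀ p ∈ C'.η.source, ∀ l : ℂ, JoinedIn {l' : ℂ | expUnit l' • p ∈ C'.η.source} 0 l →
          C'.η (expUnit l • p) = Complex.exp (c * l) • C'.η p) ∧
        -- `τ` is homogeneous of degree 0
        (∀ j k, IsHomogeneousOn (C'.τ j k) C'.η.target 0) ∧
        -- the prepotential is homogeneous of degree 2
        (∃ F, C'.IsPrepotential F ∧ IsHomogeneousOn F C'.η.target 2) ∧
        (∀ F, C'.IsPrepotential F →
          ∃ b : ℂ, IsHomogeneousOn (fun z ↦ F z + b) C'.η.target 2)) := by
  have : CompleteSpace E := FiniteDimensional.complete ℂ E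
  have hhom : ∀ x : M, IsInfinitesimalHomothety S (fun y ↦ toReal y (fundamentalVelocity E y))
      c.re c.im x := fun x ↦ isInfinitesimalHomothety_fundamentalVelocity S (hH x)
  refine ⟨isType10_fundamentalField, contMDiff_fundamentalVelocity,
    fun D hD x Y hY ↦ cx_leviCivita_fundamentalField (hhom x) hD hY,
    fun Y Z x hY hY' hZ hZ' ↦ lieDeriv_fundamentalField (hhom x) hY hY' hZ hZ',
    fun hc n C hC ↦ ?_⟩
  obtain ⟨a, a', h⟩ :=
    C.exists_translate_isHomogeneousFor contMDiff_fundamentalVelocity hhom hC hc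
  have he := fun j z (hz : z ∈ (C.translate a a').η.target) ↦ h.euler_lam hc j hz
  obtain ⟨G, hG, hG2⟩ := SpecialCoordinates.exists_isPrepotential_isHomogeneousOn he
  refine ⟨a, a', C.translate a a', rfl, fun p _ ↦ rfl, fun p _ j ↦ rfl,
    fun p hp ↦ h.toType10_eq_sum hp, fun p hp l hl ↦ funext fun j ↦ ?_,
    fun j k ↦ isHomogeneousOn_zero_of_euler (C.translate a a').η.open_target
      ((C.translate a a').contDiffOn_lam_symm k) (he k) (Pi.single j 1),
    ⟨G, hG, hG2⟩, fun F hF ↦ hF.exists_add_const_isHomogeneousOn hG hC hG2⟩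
  exact apply_expUnit_smul_of_mvfderiv (C.translate a a').η.open_source
    (fun q hq ↦ (C.translate a a').mdifferentiableAt_η_apply j hq)
    (fun q hq ↦ h.η_apply q hq j) hl
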